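/- Let $G$ be a compact Lie group with Lie algebra $\mathfrak g$, let $H\subset G$ be a closed subgroup with Lie algebra $\mathfrak h$ such that $M=G/H$ is connected, and let $Q$ be an $\mathrm{Ad}(G)$-invariant Euclidean inner product on $\mathfrak g$. Let $\mathfrak k$ be a toral $H$-subalgebra of $\mathfrak g$, i.e. an $\mathrm{Ad}(H)$-invariant Lie subalgebra with $\mathfrak h\subsetneq\mathfrak k\subsetneq\mathfrak g$ and $[\mathfrak k,\mathfrak k]\subset\mathfrak h$. Let $K$ be the subgroup of $G$ generated by $H$ and the connected Lie subgroup of $G$ with Lie algebra $\mathfrak k$. Assume that $K$ is closed in $G$, and put $N=G/K$. Write $\mathfrak m=\mathfrak h^{\perp}$, $\mathfrak t=\mathfrak k\cap\mathfrak m$ and $\mathfrak n=\mathfrak k^{\perp}$ for the $Q$-orthogonal complements, so that $\mathfrak m=\mathfrak t\oplus\mathfrak n$, $T_{eH}M\simeq\mathfrak m$ and $T_{eK}N\simeq\mathfrak n$ via $V\mapsto \frac{d}{ds}\exp(sV)\big|_{s=0}$ modulo $H$, respectively modulo $K$. A $G$-invariant Riemannian metric $g$ on $M$ (respectively on $N$)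 is identified with the $Q$-symmetric, positive definite, $\mathrm{Ad}(H)$-invariant endomorphism $P$ of $\mathfrak m$ (respectively $\mathrm{Ad}(K)$-invariant endomorphism $P$ of $\mathfrak n$) given by $Q(PV_1,V_2)=g(V_1,V_2)$. A metric $P$ on $M$ is called a $\mathfrak k$-submersion metric if $P$ preserves $\mathfrak t$ and $\mathfrak n$ and its restriction to $\mathfrak n$ is $\mathrm{Ad}(K)$-invariant; then $P=P_{\mathfrak t}\oplus P_{\mathfrak n}$. Let $P^{(n)}=P^{(n)}_{\mathfrak t}\oplus P^{(n)}_{\mathfrak n}$ be a sequence of $\mathfrak k$-submersion metrics on $M$ with $P^{(n)}_{\mathfrak t}\to 0$ and $P^{(n)}_{\mathfrak n}\to P^{(\infty)}_{\mathfrak n}$ as $n\to\infty$, where $P^{(\infty)}_{\mathfrak n}$ is a $G$-invariant Riemannian metric on $N$. Let $d^{(n)}_M$ be the Riemannian distance of $P^{(n)}$ on $M$ and $d^{(\infty)}_N$ the Riemannian distance of $P^{(\infty)}_{\mathfrak n}$ on $N$. Then $(M,d^{(n)}_M)$ and $(N,d^{(\infty)}_N)$ are compact metric spaces, and $(M,d^{(n)}_M)$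 converges to $(N,d^{(\infty)}_N)$ in the Gromov–Hausdorff topology as $n\to\infty$. -/

import Mathlib

open Set Filter Topology Manifold Bundle
open scoped ContDiff ENNReal

noncomputable section

namespace HomogeneousCollapse

section LieGroup

variable {E : Type*} [NormedAddCommGroup E] [NormedSpace ℝ E]
  {G : Type*} [TopologicalSpace G] [ChartedSpace E G] [Group G]

/-- The adjoint representation: `Ad a` is the differential at the identity of the conjugation
`x ↦ a x a⁻¹`. -/
def Ad (a : G) : GroupLieAlgebra 𝓘(ℝ, E) G →ₗ[ℝ] GroupLieAlgebra 𝓘(ℝ, E) G :=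
  (show E →L[ℝ] E from
    mfderiv 𝓘(ℝ, E) 𝓘(ℝ, E) (fun x : G => a * x * a⁻¹) (1 : G)).toLinearMap

/-- `γ` is the one-parameter subgroup `s ↦ exp (s X)`: the global integral curve through the
identity of the left-invariant vector field with value `X` at the identity. -/
def IsExpCurve (X : GroupLieAlgebra 𝓘(ℝ, E) G) (γ : ℝ → G) : Prop :=
  γ 0 = 1 ∧ IsMIntegralCurve (I := 𝓘(ℝ, E)) γ (mulInvariantVectorField X)

/-- The Lie algebra of a subgroup `H`: the vectors `X` with `exp (s X) ∈ H` for all `s`.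
For a closed subgroup `H` this set is already a linear subspace, so that taking the span adds
nothing; the span only makes it a `Submodule` by construction. -/
def lieAlgebraOf (H : Subgroup G) : Submodule ℝ (GroupLieAlgebra 𝓘(ℝ, E) G) :=
  Submodule.span ℝ {X | ∃ γ : ℝ → G, IsExpCurve X γ ∧ ∀ s, γ s ∈ H}

/-- The connected Lie subgroup `K°` with Lie algebra `k`, that is, the subgroup generated by
`exp k`. -/
def connectedLieSubgroup (k : Submodule ℝ (GroupLieAlgebra 𝓘(ℝ, E) G)) : Subgroup G :=
  Subgroup.closure {a | ∃ X ∈ k, ∃ γ : ℝ → G, IsExpCurve X γ ∧ γ 1 = a}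

/-- The subgroup `K` generated by `H` and `K°`. -/
def extendedSubgroup (H : Subgroup G) (k : Submodule ℝ (GroupLieAlgebra 𝓘(ℝ, E) G)) :
    Subgroup G :=
  H ⊔ connectedLieSubgroup k

/-- `Q` is an `Ad(G)`-invariant Euclidean inner product on the Lie algebra of `G`. -/
structure IsAdInvariantInner (Q : LinearMap.BilinForm ℝ (GroupLieAlgebra 𝓘(ℝ, E) G)) : Prop where
  symm : ∀ X Y, Q X Y = Q Y X
  pos : ∀ X, X ≠ 0 → 0 < Q X X
  ad_invariant : ∀ (a : G) X Y, Q (Ad a X) (Ad a Y) = Q X Y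

/-- `k` is a toral `H`-subalgebra: an `Ad(H)`-invariant Lie subalgebra lying properly between `h`
and the Lie algebra of `G` such that `[k, k] ⊆ h`. (Closure of `k` under the bracket follows from
`[k, k] ⊆ h ⊆ k`.) -/
structure IsToralSubalgebra (H : Subgroup G) (k : Submodule ℝ (GroupLieAlgebra 𝓘(ℝ, E) G)) :
    Prop where
  lie_lt : lieAlgebraOf H < k
  lt_top : k < ⊤
  ad_mem : ∀ a ∈ H, ∀ X ∈ k, Ad a X ∈ k
  bracket_mem : ∀ X ∈ k, ∀ Y ∈ k, ⁅X, Y⁆ ∈ lieAlgebraOf (E := E) H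

/-- `P ∈ Sym₊(V, Q|V)^{Ad(L)}`: `P` is a `Q`-symmetric, positive definite, `Ad(L)`-invariant
endomorphism of `V`. -/
structure IsInvariantMetricEndo (Q : LinearMap.BilinForm ℝ (GroupLieAlgebra 𝓘(ℝ, E) G))
    (L : Subgroup G) (V : Submodule ℝ (GroupLieAlgebra 𝓘(ℝ, E) G)) (P : Module.End ℝ V) :
    Prop where
  symm : ∀ X Y : V, Q (P X) Y = Q X (P Y)
  pos : ∀ X : V, X ≠ 0 → 0 < Q (P X) X
  ad_invariant : ∀ a ∈ L, ∀ X Y : V, Ad a (X : GroupLieAlgebra 𝓘(ℝ, E) G) = Y →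
    Ad a (P X : GroupLieAlgebra 𝓘(ℝ, E) G) = P Y

/-- `P` is a `k`-submersion metric on `M = G/H`: an `Ad(H)`-invariant metric endomorphism of
`m = h^⊥` that preserves the decomposition `m = t + n`, where `t = k ∩ m` and `n = k^⊥`, and whose
restriction to `n` is `Ad(K)`-invariant. -/
structure IsSubmersionMetric (Q : LinearMap.BilinForm ℝ (GroupLieAlgebra 𝓘(ℝ, E) G))
    (H : Subgroup G) (k : Submodule ℝ (GroupLieAlgebra 𝓘(ℝ, E) G))
    (P : Module.End ℝ (Q.orthogonal (lieAlgebraOf H))) : Prop where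
  isInvariantMetricEndo : IsInvariantMetricEndo Q H (Q.orthogonal (lieAlgebraOf H)) P
  map_t : ∀ X : Q.orthogonal (lieAlgebraOf H),
    (X : GroupLieAlgebra 𝓘(ℝ, E) G) ∈ k → (P X : GroupLieAlgebra 𝓘(ℝ, E) G) ∈ k
  map_n : ∀ X : Q.orthogonal (lieAlgebraOf H),
    (X : GroupLieAlgebra 𝓘(ℝ, E) G) ∈ Q.orthogonal k →
      (P X : GroupLieAlgebra 𝓘(ℝ, E) G) ∈ Q.orthogonal k
  ad_invariant : ∀ a ∈ extendedSubgroup H k, ∀ X Y : Q.orthogonal (lieAlgebraOf H),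
    (X : GroupLieAlgebra 𝓘(ℝ, E) G) ∈ Q.orthogonal k →
      Ad a (X : GroupLieAlgebra 𝓘(ℝ, E) G) = Y →
        Ad a (P X : GroupLieAlgebra 𝓘(ℝ, E) G) = P Y

end LieGroup

section Metric

variable {F : Type*} [NormedAddCommGroup F] [NormedSpace ℝ F]

/-- Smooth Riemannian metrics on a manifold `M` modelled on `F`. -/
abbrev SmoothMetric (F : Type*) [NormedAddCommGroup F] [NormedSpace ℝ F] (M : Type*)
    [TopologicalSpace M] [ChartedSpace F M] [IsManifold 𝓘(ℝ, F) ∞ M] :=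
  ContMDiffRiemannianMetric 𝓘(ℝ, F) ∞ F (fun x : M => TangentSpace 𝓘(ℝ, F) x)

/-- The Riemannian distance of `g`: the infimum of the `g`-lengths of the `C¹` paths between two
points. -/
def riemannianDistance {M : Type*} [TopologicalSpace M] [ChartedSpace F M]
    [IsManifold 𝓘(ℝ, F) ∞ M] (g : SmoothMetric F M) (x y : M) : ℝ≥0∞ :=
  letI : RiemannianBundle (fun x : M => TangentSpace 𝓘(ℝ, F) x) := ⟨g.toRiemannianMetric⟩
  riemannianEDist 𝓘(ℝ, F) x y

variable {E : Type*} [NormedAddCommGroup E] [NormedSpace ℝ E]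
  {G : Type*} [TopologicalSpace G] [ChartedSpace E G] [Group G]

/-- `g` is the `G`-invariant Riemannian metric on `G/L` that corresponds to the endomorphism `P` of
the complement `V ≃ T_{eL}(G/L)`, where `X ∈ V` is identified with `d/ds exp(sX)L` at `s = 0`,
that is, with the image of `X` under the differential of the projection `G → G/L`. -/
structure IsMetricOf (L : Subgroup G) [ChartedSpace F (G ⧸ L)] [IsManifold 𝓘(ℝ, F) ∞ (G ⧸ L)]
    (Q : LinearMap.BilinForm ℝ (GroupLieAlgebra 𝓘(ℝ, E) G))
    (V : Submodule ℝ (GroupLieAlgebra 𝓘(ℝ, E) G)) (P : Module.End ℝ V)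
    (g : SmoothMetric F (G ⧸ L)) : Prop where
  invariant : ∀ (a : G) (x : G ⧸ L) (v w : TangentSpace 𝓘(ℝ, F) x),
    g.inner (a • x) (mfderiv 𝓘(ℝ, F) 𝓘(ℝ, F) (fun y : G ⧸ L => a • y) x v)
      (mfderiv 𝓘(ℝ, F) 𝓘(ℝ, F) (fun y : G ⧸ L => a • y) x w) = g.inner x v w
  inner_eq : ∀ X Y : V,
    g.inner ((1 : G) : G ⧸ L)
      (mfderiv 𝓘(ℝ, E) 𝓘(ℝ, F) (fun a : G => (a : G ⧸ L)) (1 : G) (X : GroupLieAlgebra 𝓘(ℝ, E) G))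
      (mfderiv 𝓘(ℝ, E) 𝓘(ℝ, F) (fun a : G => (a : G ⧸ L)) (1 : G) (Y : GroupLieAlgebra 𝓘(ℝ, E) G))
      = Q (P X) Y

end Metric

/-- `d` is the distance function of a compact metric space structure on `X`. -/
structure IsCompactMetric {X : Type*} (d : X → X → ℝ≥0∞) (m : MetricSpace X) : Prop where
  edist_eq : ∀ x y : X, edist x y = d x y
  compactSpace : CompactSpace X

/-- The functions `dX n` and `dY` are distance functions of nonempty compact metric spaces, and
`(X, dX n)` converges to `(Y, dY)` in the Gromov–Hausdorff topology. -/
def GromovHausdorffTendsto {X Y : Type*} (dX : ℕ → X → X → ℝ≥0∞) (dY : Y → Y → ℝ≥0∞) : Prop :=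
  ∃ (mX : ℕ → MetricSpace X) (mY : MetricSpace Y) (hX : ∀ n, IsCompactMetric (dX n) (mX n))
    (hY : IsCompactMetric dY mY) (neX : Nonempty X) (neY : Nonempty Y),
    Tendsto
      (fun n => @GromovHausdorff.toGHSpace X (mX n) (hX n).compactSpace neX) atTop
      (𝓝 (@GromovHausdorff.toGHSpace Y mY hY.compactSpace neY))

end HomogeneousCollapse

end

/-! The projection `projection H k`, from `G/H` onto `G/K`, has distortion tending to zero. For
every `η > 0` and all large `n`, writing `π` for it, one shows `d_N(π x, π y) ≤ (1 + η) d_M(x, y)`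
and `d_M(x, y) ≤ (1 + η) d_N(π x, π y) + η`. A surjection with these bounds onto a space of finite
diameter forces Gromov–Hausdorff convergence (`gromovHausdorffTendsto_of_surjective`).

By homogeneity every norm estimate reduces to the base point, where tangent vectors split into a
vertical part in `t` and a horizontal part in `n`. In finite dimension, convergence on `n` is
uniform relative to the limit form, so horizontal norms upstairs and downstairs eventually agree up
to the factor `1 + η` (`eventually_form_le`). Since `π` kills vertical vectors, which are orthogonal
to horizontal ones, the first bound follows (`riemannianDistance_projection_le`).

For the second bound, a nearly minimal curve in `G/K` is followed upstairs to a point in the fibre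
of the target (`exists_projection_eq_riemannianDistance_le`). No horizontal lift of the whole curve
is constructed: a local lift that is horizontal at one instant stays nearly horizontal for a short
time, and a continuous induction on `[0, 1]` accumulates the distance estimates. It remains to move
inside the fibre. The elements of `G` that displace the base point by an amount tending to zero form
a subgroup, because `G` acts by isometries; it contains `H` and `exp k`, hence `K`. Compactness of
`K` and a Lipschitz bound uniform in `n` make the collapse uniform
(`eventually_forall_riemannianDistance_le`). -/

noncomputable section

namespace HomogeneousCollapse

/-! ### Speeds, lengths and Riemannian distances -/

section RiemannianDistance

variable {F : Type*} [NormedAddCommGroup F] [NormedSpace ℝ F]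
  {M : Type*} [TopologicalSpace M] [ChartedSpace F M] [IsManifold 𝓘(ℝ, F) ∞ M]

/-- The norm of a tangent vector for a smooth metric. -/
def tangentNorm (g : SmoothMetric F M) (x : M) (v : F) : ℝ :=
  √(g.inner x v v)

/-- The differential of a map, as a linear map between the model spaces. -/
def differential (F) [NormedAddCommGroup F] [NormedSpace ℝ F] {M : Type*} [TopologicalSpace M]
    [ChartedSpace F M] (F' : Type*) [NormedAddCommGroup F'] [NormedSpace ℝ F'] {M' : Type*}
    [TopologicalSpace M'] [ChartedSpace F' M'] (f : M → M') (x : M) : F →L[ℝ] F' :=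
  mfderiv 𝓘(ℝ, F) 𝓘(ℝ, F') f x

omit [IsManifold 𝓘(ℝ, F) ∞ M] in
lemma differential_comp {F' F'' : Type*} [NormedAddCommGroup F'] [NormedSpace ℝ F']
    [NormedAddCommGroup F''] [NormedSpace ℝ F''] {M' M'' : Type*}
    [TopologicalSpace M'] [ChartedSpace F' M'] [TopologicalSpace M''] [ChartedSpace F'' M'']
    {f : M' → M''} {h : M → M'} {x : M} (hf : MDifferentiableAt 𝓘(ℝ, F') 𝓘(ℝ, F'') f (h x))
    (hh : MDifferentiableAt 𝓘(ℝ, F) 𝓘(ℝ, F') h x) :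
    differential F F'' (f ∘ h) x = (differential F' F'' f (h x)).comp (differential F F' h x) :=
  mfderiv_comp x hf hh

omit [IsManifold 𝓘(ℝ, F) ∞ M] in
lemma differential_congr {F' : Type*} [NormedAddCommGroup F'] [NormedSpace ℝ F'] {M' : Type*}
    [TopologicalSpace M'] [ChartedSpace F' M'] {f f' : M → M'} {x : M} (h : f =ᶠ[𝓝 x] f') :
    differential F F' f x = differential F F' f' x :=
  h.mfderiv_eq

omit [IsManifold 𝓘(ℝ, F) ∞ M] in
lemma differential_id (x : M) : differential F F (id : M → M) x = ContinuousLinearMap.id ℝ F :=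
  mfderiv_id

/-- The velocity vector of a curve. -/
def velocity (F) [NormedAddCommGroup F] [NormedSpace ℝ F] {M : Type*} [TopologicalSpace M]
    [ChartedSpace F M] (γ : ℝ → M) (t : ℝ) : F :=
  differential ℝ F γ t (1 : ℝ)

/-- The speed of a curve with respect to a smooth metric. -/
def speed (g : SmoothMetric F M) (γ : ℝ → M) (t : ℝ) : ℝ :=
  tangentNorm g (γ t) (velocity F γ t)

lemma speed_nonneg (g : SmoothMetric F M) (γ : ℝ → M) (t : ℝ) : 0 ≤ speed g γ t :=
  Real.sqrt_nonneg _

/-- Curves that are `C¹` at a point have a continuous velocity there. -/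
lemma continuousAt_velocity {γ : ℝ → M} {t : ℝ} (hγ : ContMDiffAt 𝓘(ℝ, ℝ) 𝓘(ℝ, F) 1 γ t) :
    ContinuousAt (fun t => (⟨γ t, velocity F γ t⟩ : TangentBundle 𝓘(ℝ, F) M)) t := by
  have : IsManifold 𝓘(ℝ, F) 1 M := IsManifold.of_le (n := ∞) (by simp)
  obtain ⟨u, hu, hγu⟩ := (contMDiffAt_iff_contMDiffOn_nhds (by simp)).1 hγ
  obtain ⟨w, hwu, hw, htw⟩ := mem_nhds_iff.1 hu
  have h1 := (hγu.mono hwu).continuousOn_tangentMapWithin le_rfl hw.uniqueMDiffOn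
  -- The velocity is the tangent map of `γ` applied to the constant unit vector field on ℝ, so
  -- continuity of this field and of the tangent map suffices.
  have h2 : Continuous (fun t : ℝ => (⟨t, (1 : ℝ)⟩ : TangentBundle 𝓘(ℝ, ℝ) ℝ)) :=
    (tangentBundleModelSpaceHomeomorph 𝓘(ℝ, ℝ)).symm.continuous.comp
      (continuous_id.prodMk continuous_const)
  have h3 : ContinuousOn (fun t : ℝ => tangentMapWithin 𝓘(ℝ, ℝ) 𝓘(ℝ, F) γ w
      (⟨t, (1 : ℝ)⟩ : TangentBundle 𝓘(ℝ, ℝ) ℝ)) w :=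
    h1.comp h2.continuousOn fun t ht => ht
  refine (h3.continuousAt (hw.mem_nhds htw)).congr ?_
  filter_upwards [hw.mem_nhds htw] with s hs
  simp [tangentMapWithin, velocity, differential, mfderivWithin_of_isOpen hw hs]
  rfl

omit [IsManifold 𝓘(ℝ, F) ∞ M] in
/-- The velocity of the image of a curve. -/
lemma velocity_comp {F' : Type*} [NormedAddCommGroup F'] [NormedSpace ℝ F']
    {M' : Type*} [TopologicalSpace M'] [ChartedSpace F' M'] {f : M → M'} {γ : ℝ → M} {t : ℝ}
    (hf : MDifferentiableAt 𝓘(ℝ, F) 𝓘(ℝ, F') f (γ t))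
    (hγ : MDifferentiableAt 𝓘(ℝ, ℝ) 𝓘(ℝ, F) γ t) :
    velocity F' (f ∘ γ) t =
      differential F F' f (γ t) (velocity F γ t) := by
  rw [velocity, differential_comp hf hγ]
  rfl

/-- The Riemannian distance is bounded by the integral of the speed of a `C¹` curve. -/
lemma riemannianDistance_le_lintegral_speed (g : SmoothMetric F M) {γ : ℝ → M} {a b : ℝ}
    (hab : a ≤ b) (hγ : ContMDiffOn 𝓘(ℝ, ℝ) 𝓘(ℝ, F) 1 γ (Icc a b)) :
    riemannianDistance g (γ a) (γ b) ≤ ∫⁻ t in Icc a b, ENNReal.ofReal (speed g γ t) := by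
  let : RiemannianBundle (fun x : M => TangentSpace 𝓘(ℝ, F) x) := ⟨g.toRiemannianMetric⟩
  refine (riemannianEDist_le_pathELength hγ rfl rfl hab).trans_eq ?_
  rw [pathELength_eq_lintegral_mfderiv_Icc]
  refine MeasureTheory.lintegral_congr fun t => ?_
  rw [← ofReal_norm, norm_eq_sqrt_real_inner]
  rfl

/-- The Riemannian distance is approximated by the lengths of globally defined `C¹` curves. -/
lemma exists_lintegral_speed_lt (g : SmoothMetric F M) {x y : M} {r : ℝ≥0∞}
    (h : riemannianDistance g x y < r) :
    ∃ γ : ℝ → M, γ 0 = x ∧ γ 1 = y ∧ ContMDiff 𝓘(ℝ, ℝ) 𝓘(ℝ, F) 1 γ ∧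
      ∫⁻ t in Icc (0 : ℝ) 1, ENNReal.ofReal (speed g γ t) < r := by
  let : RiemannianBundle (fun x : M => TangentSpace 𝓘(ℝ, F) x) := ⟨g.toRiemannianMetric⟩
  -- Almost minimal curves can be taken constant near both endpoints; this is what allows them to be
  -- `C¹` on the whole line.
  obtain ⟨γ, h0, h1, hγ, hl, -, -⟩ :=
    exists_lt_locally_constant_of_riemannianEDist_lt (I := 𝓘(ℝ, F)) h zero_lt_one
  refine ⟨γ, h0, h1, hγ, lt_of_eq_of_lt ?_ hl⟩
  rw [pathELength_eq_lintegral_mfderiv_Icc]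
  refine MeasureTheory.lintegral_congr fun t => ?_
  rw [← ofReal_norm, norm_eq_sqrt_real_inner]
  rfl

lemma riemannianDistance_triangle (g : SmoothMetric F M) (x y z : M) :
    riemannianDistance g x z ≤ riemannianDistance g x y + riemannianDistance g y z := by
  let : RiemannianBundle (fun x : M => TangentSpace 𝓘(ℝ, F) x) := ⟨g.toRiemannianMetric⟩
  exact riemannianEDist_triangle

lemma riemannianDistance_comm (g : SmoothMetric F M) (x y : M) :
    riemannianDistance g x y = riemannianDistance g y x := by
  let : RiemannianBundle (fun x : M => TangentSpace 𝓘(ℝ, F) x) := ⟨g.toRiemannianMetric⟩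
  exact riemannianEDist_comm

lemma riemannianDistance_self (g : SmoothMetric F M) (x : M) :
    riemannianDistance g x x = 0 := by
  let : RiemannianBundle (fun x : M => TangentSpace 𝓘(ℝ, F) x) := ⟨g.toRiemannianMetric⟩
  exact riemannianEDist_self

lemma eventually_riemannianDistance_lt (g : SmoothMetric F M) (x : M) {c : ℝ≥0∞} (hc : 0 < c) :
    ∀ᶠ y in 𝓝 x, riemannianDistance g x y < c := by
  let : RiemannianBundle (fun x : M => TangentSpace 𝓘(ℝ, F) x) := ⟨g.toRiemannianMetric⟩
  have : IsManifold 𝓘(ℝ, F) 1 M := IsManifold.of_le (n := ∞) (by simp)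
  have : IsContinuousRiemannianBundle F (fun x : M => TangentSpace 𝓘(ℝ, F) x) :=
    ⟨g.inner, g.contMDiff.continuous, fun _ _ _ => rfl⟩
  exact eventually_riemannianEDist_lt 𝓘(ℝ, F) x hc

/-- A `C¹` map whose differential multiplies norms by at most `C` multiplies Riemannian distances
by at most `C`. -/
lemma riemannianDistance_map_le {F' : Type*} [NormedAddCommGroup F'] [NormedSpace ℝ F']
    {M' : Type*} [TopologicalSpace M'] [ChartedSpace F' M'] [IsManifold 𝓘(ℝ, F') ∞ M']
    (g : SmoothMetric F M) (g' : SmoothMetric F' M') {f : M → M'}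
    (hf : ContMDiff 𝓘(ℝ, F) 𝓘(ℝ, F') 1 f) {C : ℝ} (hC : 0 < C)
    (h : ∀ x v, tangentNorm g' (f x) (differential F F' f x v) ≤ C * tangentNorm g x v)
    (x y : M) :
    riemannianDistance g' (f x) (f y) ≤ ENNReal.ofReal C * riemannianDistance g x y := by
  have key : ∀ r, riemannianDistance g x y < r →
      riemannianDistance g' (f x) (f y) ≤ ENNReal.ofReal C * r := by
    intro r hr
    obtain ⟨γ, rfl, rfl, hγ, hl⟩ := exists_lintegral_speed_lt g hr
    refine (riemannianDistance_le_lintegral_speed g' (γ := f ∘ γ) zero_le_one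
      (hf.comp hγ).contMDiffOn).trans ?_
    calc ∫⁻ t in Icc (0 : ℝ) 1, ENNReal.ofReal (speed g' (f ∘ γ) t)
        ≤ ∫⁻ t in Icc (0 : ℝ) 1, ENNReal.ofReal C * ENNReal.ofReal (speed g γ t) := by
          refine MeasureTheory.lintegral_mono fun t => ?_
          rw [← ENNReal.ofReal_mul hC.le]
          refine ENNReal.ofReal_le_ofReal ?_
          rw [speed, velocity_comp (hf.mdifferentiable (by simp) _)
            (hγ.mdifferentiable (by simp) _)]
          exact h _ _
      _ = ENNReal.ofReal C * ∫⁻ t in Icc (0 : ℝ) 1, ENNReal.ofReal (speed g γ t) :=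
          MeasureTheory.lintegral_const_mul' _ _ ENNReal.ofReal_ne_top
      _ ≤ ENNReal.ofReal C * r := by gcongr
  have hC0 : ENNReal.ofReal C ≠ 0 := by simpa using hC
  rw [← ENNReal.div_le_iff' hC0 ENNReal.ofReal_ne_top]
  refine le_of_forall_gt_imp_ge_of_dense fun r hr => ?_
  exact (ENNReal.div_le_iff' hC0 ENNReal.ofReal_ne_top).2 (key r hr)

/-- The Riemannian distance on a compact connected manifold is a compact metric. -/
lemma exists_isCompactMetric [T2Space M] [CompactSpace M] [ConnectedSpace M]
    (g : SmoothMetric F M) :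
    ∃ m : MetricSpace M, IsCompactMetric (riemannianDistance g) m := by
  let : RiemannianBundle (fun x : M => TangentSpace 𝓘(ℝ, F) x) := ⟨g.toRiemannianMetric⟩
  have : IsManifold 𝓘(ℝ, F) 1 M := IsManifold.of_le (n := ∞) (by simp)
  have : IsContinuousRiemannianBundle F (fun x : M => TangentSpace 𝓘(ℝ, F) x) :=
    ⟨g.inner, g.contMDiff.continuous, fun _ _ _ => rfl⟩
  let e : EMetricSpace M := EMetricSpace.ofRiemannianMetric 𝓘(ℝ, F) M
  have hfin : ∀ x y : M, edist x y ≠ ⊤ := by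
    intro x y
    -- The points at finite distance from `x` form a clopen set, so connectedness makes every
    -- distance finite.
    have hcl : IsClopen (Metric.eball x ⊤) := ⟨Metric.isClosed_eball_top, Metric.isOpen_eball⟩
    have hy : y ∈ Metric.eball x ⊤ := by
      rw [hcl.eq_univ ⟨x, Metric.mem_eball_self ENNReal.zero_lt_top⟩]
      exact mem_univ y
    rw [edist_comm]
    exact (Metric.mem_eball.1 hy).ne
  let m : MetricSpace M := EMetricSpace.toMetricSpace hfin
  exact ⟨m, fun x y => rfl, ‹CompactSpace M›⟩

/-- The Riemannian distance is continuous. -/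
lemma continuous_riemannianDistance [T3Space M] (g : SmoothMetric F M) (x : M) :
    Continuous (riemannianDistance g x) := by
  let : RiemannianBundle (fun x : M => TangentSpace 𝓘(ℝ, F) x) := ⟨g.toRiemannianMetric⟩
  have : IsManifold 𝓘(ℝ, F) 1 M := IsManifold.of_le (n := ∞) (by simp)
  have : IsContinuousRiemannianBundle F (fun x : M => TangentSpace 𝓘(ℝ, F) x) :=
    ⟨g.inner, g.contMDiff.continuous, fun _ _ _ => rfl⟩
  let : EMetricSpace M := EMetricSpace.ofRiemannianMetric 𝓘(ℝ, F) M
  exact continuous_const.edist continuous_id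

/-- The speed of a `C¹` curve is continuous. -/
lemma continuousAt_speed (g : SmoothMetric F M) {γ : ℝ → M} {t : ℝ}
    (hγ : ContMDiffAt 𝓘(ℝ, ℝ) 𝓘(ℝ, F) 1 γ t) : ContinuousAt (speed g γ) t := by
  let : RiemannianBundle (fun x : M => TangentSpace 𝓘(ℝ, F) x) := ⟨g.toRiemannianMetric⟩
  have : IsManifold 𝓘(ℝ, F) 1 M := IsManifold.of_le (n := ∞) (by simp)
  have : IsContinuousRiemannianBundle F (fun x : M => TangentSpace 𝓘(ℝ, F) x) :=
    ⟨g.inner, g.contMDiff.continuous, fun _ _ _ => rfl⟩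
  have h1 : ContinuousAt (fun t => (⟨γ t, velocity F γ t⟩ : TangentBundle 𝓘(ℝ, F) M)) t :=
    continuousAt_velocity hγ
  exact (h1.inner_bundle h1).sqrt

end RiemannianDistance

/-! ### Local sections of submersions -/

section Submersion

variable {E F F' : Type*} [NormedAddCommGroup E] [NormedSpace ℝ E] [NormedAddCommGroup F]
  [NormedSpace ℝ F] [NormedAddCommGroup F'] [NormedSpace ℝ F']
  {A B C : Type*} [TopologicalSpace A] [ChartedSpace E A]
  [TopologicalSpace B] [ChartedSpace F B] [TopologicalSpace C] [ChartedSpace F' C]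

/-- A submersion has a smooth local section through every point. -/
lemma exists_local_section {p : A → B} [IsManifold 𝓘(ℝ, E) ∞ A] [IsManifold 𝓘(ℝ, F) ∞ B]
    (hp : IsSubmersion 𝓘(ℝ, E) 𝓘(ℝ, F) ∞ p) (a : A) :
    ∃ s : B → A, s (p a) = a ∧ ContMDiffAt 𝓘(ℝ, F) 𝓘(ℝ, E) ∞ s (p a) ∧
      ∀ᶠ y in 𝓝 (p a), p (s y) = y := by
  have h := hp.isSubmersionAt a
  set φ := h.domChart.extend 𝓘(ℝ, E) with hφ
  set ψ := h.codChart.extend 𝓘(ℝ, F) with hψ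
  have haφ : a ∈ φ.source := by simpa [hφ] using h.mem_domChart_source
  have haψ : p a ∈ ψ.source := by simpa [hψ] using h.mem_codChart_source
  have hwr := h.writtenInCharts
  -- In the adapted charts `p` is the first-factor projection; the section freezes the second
  -- coordinate at its value at `a`.
  let w : F → E := fun u => h.equiv.symm (u, (h.equiv (φ a)).2)
  have hw0 : w (ψ (p a)) = φ a := by
    have h1 : ψ (p a) = (h.equiv (φ a)).1 := by
      have := hwr (φ.map_source haφ)
      simp only [Function.comp_apply] at this
      rw [← hφ, ← hψ, φ.left_inv haφ] at this
      exact this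
    simp [w, h1]
  have hψc : ContMDiffAt 𝓘(ℝ, F) 𝓘(ℝ, F) ∞ ψ (p a) :=
    contMDiffAt_of_mem_maximalAtlas h.codChart_mem_maximalAtlas h.mem_codChart_source
  have hopen : IsOpen φ.target := by
    rw [hφ]; exact h.domChart.isOpen_extend_target
  have hwc : ContMDiffAt 𝓘(ℝ, F) 𝓘(ℝ, E) ∞ (fun y => w (ψ y)) (p a) := by
    have h1 : ContDiff ℝ ∞ w := h.equiv.symm.contDiff.comp (contDiff_id.prodMk contDiff_const)
    exact h1.contMDiff.contMDiffAt.comp _ hψc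
  have hsymm : ContMDiffAt 𝓘(ℝ, E) 𝓘(ℝ, E) ∞ φ.symm (w (ψ (p a))) := by
    rw [hw0]
    refine (contMDiffOn_extend_symm h.domChart_mem_maximalAtlas).contMDiffAt ?_
    rw [← OpenPartialHomeomorph.extend_target']
    exact hopen.mem_nhds (φ.map_source haφ)
  refine ⟨fun y => φ.symm (w (ψ y)), ?_, ContMDiffAt.comp (g := φ.symm) (p a) hsymm hwc, ?_⟩
  · simp only [hw0, φ.left_inv haφ]
  · have h1 : ∀ᶠ y in 𝓝 (p a), w (ψ y) ∈ φ.target := by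
      refine hwc.continuousAt.preimage_mem_nhds ?_
      simp only [hw0]
      exact hopen.mem_nhds (φ.map_source haφ)
    have h2 : ∀ᶠ y in 𝓝 (p a), y ∈ ψ.source := by
      rw [hψ, OpenPartialHomeomorph.extend_source]
      exact h.codChart.open_source.mem_nhds h.mem_codChart_source
    filter_upwards [h1, h2] with y hy1 hy2
    have h3 := hwr hy1
    simp only [Function.comp_apply, w, ContinuousLinearEquiv.apply_symm_apply] at h3
    refine ψ.injOn ?_ hy2 h3
    have h4 := φ.map_target hy1
    have h5 := h.source_subset_preimage_source (a := φ.symm (w (ψ y)))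
      (by simpa [hφ] using h4)
    simpa [hψ] using h5

/-- Smoothness of a map out of the base of a surjective submersion can be tested upstairs. -/
lemma contMDiff_of_comp_submersion {p : A → B} [IsManifold 𝓘(ℝ, E) ∞ A] [IsManifold 𝓘(ℝ, F) ∞ B]
    (hp : IsSubmersion 𝓘(ℝ, E) 𝓘(ℝ, F) ∞ p) (hsurj : Function.Surjective p) {f : B → C}
    (hf : ContMDiff 𝓘(ℝ, E) 𝓘(ℝ, F') ∞ (f ∘ p)) : ContMDiff 𝓘(ℝ, F) 𝓘(ℝ, F') ∞ f := by
  intro b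
  obtain ⟨a, rfl⟩ := hsurj b
  obtain ⟨s, hs0, hs, hsec⟩ := exists_local_section hp a
  -- Near `p a` the map `f` coincides with `(f ∘ p) ∘ s`, since `s` is a local section.
  have h1 : ContMDiffAt 𝓘(ℝ, F) 𝓘(ℝ, F') ∞ ((f ∘ p) ∘ s) (p a) := hf.contMDiffAt.comp _ hs
  refine h1.congr_of_eventuallyEq ?_
  filter_upwards [hsec] with y hy
  simp [hy]

/-- The differential of a submersion is surjective. -/
lemma differential_surjective_of_submersion {p : A → B} [IsManifold 𝓘(ℝ, E) ∞ A]
    [IsManifold 𝓘(ℝ, F) ∞ B] (hp : IsSubmersion 𝓘(ℝ, E) 𝓘(ℝ, F) ∞ p) (a : A) :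
    Function.Surjective (differential E F p a : E →L[ℝ] F) := by
  intro v
  obtain ⟨s, hs0, hs, hsec⟩ := exists_local_section hp a
  have h1 : differential F F (p ∘ s) (p a) = ContinuousLinearMap.id ℝ F := by
    rw [← differential_id (p a)]
    exact differential_congr hsec
  rw [differential_comp (by
    rw [hs0]; exact (hp.contMDiff a).mdifferentiableAt (by simp)) (hs.mdifferentiableAt (by simp)),
    hs0] at h1
  exact ⟨differential F E s (p a) v, congrArg (fun L => L v) h1⟩

end Submersion

/-! ### Integral curves and one-parameter subgroups -/

section IntegralCurve

variable {E : Type*} [NormedAddCommGroup E] [NormedSpace ℝ E]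
  {M : Type*} [TopologicalSpace M] [ChartedSpace E M] [IsManifold 𝓘(ℝ, E) ∞ M]

/-- Integral curves of continuous vector fields are `C¹`. -/
lemma contMDiff_of_isMIntegralCurve {γ : ℝ → M} {v : (x : M) → TangentSpace 𝓘(ℝ, E) x}
    (hv : Continuous fun x => (⟨x, v x⟩ : TangentBundle 𝓘(ℝ, E) M))
    (hγ : IsMIntegralCurve (I := 𝓘(ℝ, E)) γ v) : ContMDiff 𝓘(ℝ, ℝ) 𝓘(ℝ, E) 1 γ := by
  have : IsManifold 𝓘(ℝ, E) 1 M := IsManifold.of_le (n := ∞) (by simp)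
  intro t₀
  rw [contMDiffAt_iff]
  refine ⟨hγ.continuous.continuousAt, ?_⟩
  simp only [extChartAt_model_space_eq_id, PartialEquiv.refl_symm, PartialEquiv.refl_coe,
    Function.comp_id, modelWithCornersSelf_coe, range_id, contDiffWithinAt_univ, id]
  obtain ⟨u, hu, hder⟩ := eventually_iff_exists_mem.1
    (hγ.isMIntegralCurveAt t₀).eventually_hasDerivAt
  have hsrc := hγ.continuous.continuousAt.preimage_mem_nhds
    (chart_source_mem_nhds E (γ t₀))
  rw [contDiffAt_one_iff]
  refine ⟨_, _, inter_mem hu hsrc, ?_, fun t ht => (hder t ht.1).hasFDerivAt⟩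
  -- The derivative of `γ` read in the chart at `γ t₀` is the vector field along `γ` read in the
  -- corresponding trivialization, hence continuous.
  have h1 : ContinuousOn (fun t => (trivializationAt E (TangentSpace 𝓘(ℝ, E)) (γ t₀)
      ⟨γ t, v (γ t)⟩).2) (u ∩ γ ⁻¹' (chartAt E (γ t₀)).source) := by
    refine continuous_snd.comp_continuousOn
      ((trivializationAt E (TangentSpace 𝓘(ℝ, E)) (γ t₀)).continuousOn.comp
        (hv.comp hγ.continuous).continuousOn fun t ht => ?_)
    simpa [TangentBundle.trivializationAt_source] using ht.2
  exact (ContinuousLinearMap.toSpanSingletonCLE (𝕜 := ℝ) (E := E)).continuous.comp_continuousOn h1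

omit [IsManifold 𝓘(ℝ, E) ∞ M] in
lemma velocity_of_isMIntegralCurve {γ : ℝ → M} {v : (x : M) → TangentSpace 𝓘(ℝ, E) x}
    (hγ : IsMIntegralCurve (I := 𝓘(ℝ, E)) γ v) (t : ℝ) : velocity E γ t = v (γ t) := by
  rw [velocity, differential, (hγ t).mfderiv]
  exact one_smul ℝ (v (γ t))

end IntegralCurve

section Exponential

variable {E : Type*} [NormedAddCommGroup E] [NormedSpace ℝ E]
  {G : Type*} [TopologicalSpace G] [ChartedSpace E G] [Group G] [LieGroup 𝓘(ℝ, E) ∞ G]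

lemma contMDiff_one_mulInvariantVectorField (X : GroupLieAlgebra 𝓘(ℝ, E) G) :
    ContMDiff 𝓘(ℝ, E) 𝓘(ℝ, E).tangent 1
      (fun a : G => (⟨a, mulInvariantVectorField X a⟩ : TangentBundle 𝓘(ℝ, E) G)) := by
  have : LieGroup 𝓘(ℝ, E) (minSmoothness ℝ 3) G :=
    LieGroup.of_le (n := ∞) (by simpa using ENat.LEInfty.out)
  exact (contMDiff_mulInvariantVectorField X).of_le (by simp)

lemma contMDiff_of_isExpCurve {X : GroupLieAlgebra 𝓘(ℝ, E) G} {γ : ℝ → G}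
    (hγ : IsExpCurve X γ) : ContMDiff 𝓘(ℝ, ℝ) 𝓘(ℝ, E) 1 γ :=
  contMDiff_of_isMIntegralCurve (contMDiff_one_mulInvariantVectorField X).continuous hγ.2

omit [LieGroup 𝓘(ℝ, E) ∞ G] in
lemma velocity_of_isExpCurve {X : GroupLieAlgebra 𝓘(ℝ, E) G} {γ : ℝ → G}
    (hγ : IsExpCurve X γ) (t : ℝ) : velocity E γ t = mulInvariantVectorField X (γ t) :=
  velocity_of_isMIntegralCurve hγ.2 t

omit [LieGroup 𝓘(ℝ, E) ∞ G] in
lemma IsExpCurve.comp_mul {X : GroupLieAlgebra 𝓘(ℝ, E) G} {γ : ℝ → G}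
    (hγ : IsExpCurve X γ) (c : ℝ) : IsExpCurve (c • X) (fun t => γ (t * c)) := by
  refine ⟨by simpa using hγ.1, ?_⟩
  rw [mulInvariantVectorField_smul]
  exact hγ.2.comp_mul c

/-- Differentials of left translations compose. -/
lemma differential_mul_left_mulInvariantVectorField (a b : G) (X : GroupLieAlgebra 𝓘(ℝ, E) G) :
    differential E E (fun x : G => a * x) b (mulInvariantVectorField X b) =
      mulInvariantVectorField X (a * b) := by
  have hd : ∀ a b : G, MDifferentiableAt 𝓘(ℝ, E) 𝓘(ℝ, E) (fun x : G => a * x) b := fun a b =>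
    (contMDiff_mul_left (I := 𝓘(ℝ, E)) (n := ∞)).mdifferentiableAt (by simp)
  have h1 : (fun x : G => a * b * x) = (fun x : G => a * x) ∘ fun x : G => b * x := by
    ext x; simp [mul_assoc]
  have h2 := differential_comp (x := (1 : G)) (hd a (b * 1)) (hd b 1)
  rw [← h1, mul_one] at h2
  exact (congrArg (fun L => L X) h2).symm

/-- One-parameter subgroups exist. -/
lemma exists_isExpCurve [FiniteDimensional ℝ E] [T2Space G] (X : GroupLieAlgebra 𝓘(ℝ, E) G) :
    ∃ γ : ℝ → G, IsExpCurve X γ := by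
  have := FiniteDimensional.complete ℝ E
  have : IsManifold 𝓘(ℝ, E) 1 G := IsManifold.of_le (n := ∞) (by simp)
  have hv := contMDiff_one_mulInvariantVectorField X
  obtain ⟨γ, hγ0, hγ⟩ := exists_isMIntegralCurveAt_of_contMDiffAt_boundaryless (t₀ := 0)
    (hv.contMDiffAt (x := (1 : G)))
  obtain ⟨ε, hε, hγ⟩ := isMIntegralCurveAt_iff'.1 hγ
  -- Left translates of the local curve through `1` are integral curves through every point with the
  -- same lifetime `ε`; a uniform lifetime gives a global curve.
  refine exists_isMIntegralCurve_of_isMIntegralCurveOn hv hε (fun x => ?_) 1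
  refine ⟨fun t => x * γ t, by simp [hγ0], fun t ht => ?_⟩
  have h1 := hγ t (by simpa [Real.ball_eq_Ioo] using ht)
  have h2 : HasMFDerivAt 𝓘(ℝ, E) 𝓘(ℝ, E) (fun y : G => x * y) (γ t)
      (mfderiv 𝓘(ℝ, E) 𝓘(ℝ, E) (fun y : G => x * y) (γ t)) :=
    ((contMDiff_mul_left (I := 𝓘(ℝ, E)) (n := ∞)).mdifferentiableAt (by simp)).hasMFDerivAt
  have h3 := h2.comp_hasMFDerivWithinAt t h1
  rw [Real.ball_eq_Ioo] at h3
  simp only [zero_sub, zero_add] at h3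
  refine HasMFDerivWithinAt.congr_mfderiv h3 ?_
  have h4 := differential_mul_left_mulInvariantVectorField x (γ t) X
  refine ContinuousLinearMap.ext fun (c : ℝ) => ?_
  exact (map_smul (differential E E (fun y : G => x * y) (γ t)) c _).trans (congrArg (c • ·) h4)

end Exponential

/-! ### Orthogonal splitting and the tangent space of a quotient -/

section Orthogonal

/-- Orthogonal decomposition for a positive definite symmetric bilinear form. -/
lemma exists_add_mem_orthogonal {V : Type*} [AddCommGroup V] [Module ℝ V] [FiniteDimensional ℝ V]
    {Q : LinearMap.BilinForm ℝ V} (hsymm : ∀ X Y, Q X Y = Q Y X) (hpos : ∀ X, X ≠ 0 → 0 < Q X X)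
    (W : Submodule ℝ V) (X : V) : ∃ Y ∈ W, ∃ Z ∈ Q.orthogonal W, Y + Z = X := by
  have hrefl : Q.IsRefl := fun x y h => by rw [hsymm]; exact h
  have hW : (Q.restrict W).Nondegenerate := by
    constructor
    · intro x hx
      by_contra h
      exact (hpos x (by simpa using h)).ne' (hx x)
    · intro x hx
      by_contra h
      exact (hpos x (by simpa using h)).ne' (hx x)
  have hcompl := Q.isCompl_orthogonal_of_restrict_nondegenerate hrefl hW
  exact Submodule.mem_sup.1 (hcompl.sup_eq_top ▸ Submodule.mem_top)

end Orthogonal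

section Quotient

variable {E F : Type*} [NormedAddCommGroup E] [NormedSpace ℝ E]
  [NormedAddCommGroup F] [NormedSpace ℝ F]
  {G : Type*} [TopologicalSpace G] [ChartedSpace E G] [Group G]
  {L : Subgroup G} [ChartedSpace F (G ⧸ L)]

variable (E F L) in
/-- The differential at the identity of the projection `G → G/L`. -/
def baseDifferential : GroupLieAlgebra 𝓘(ℝ, E) G →L[ℝ] F :=
  differential E F (fun a : G => (a : G ⧸ L)) 1

section Smooth

variable [LieGroup 𝓘(ℝ, E) ∞ G] [IsManifold 𝓘(ℝ, F) ∞ (G ⧸ L)]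

/-- Left multiplication on `G` covers the action on `G/L`, and smoothness descends through the
submersion. -/
lemma contMDiff_smul_quotient
    (hp : IsSubmersion 𝓘(ℝ, E) 𝓘(ℝ, F) ∞ (fun a : G => (a : G ⧸ L))) (a : G) :
    ContMDiff 𝓘(ℝ, F) 𝓘(ℝ, F) ∞ (fun y : G ⧸ L => a • y) :=
  contMDiff_of_comp_submersion hp Quotient.mk_surjective
    (hp.contMDiff.comp (contMDiff_mul_left (I := 𝓘(ℝ, E)) (a := a)))

/-- The projection intertwines left-invariant vector fields with translates of tangent vectors at
the base point. -/
lemma differential_mk_mulInvariantVectorField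
    (hp : IsSubmersion 𝓘(ℝ, E) 𝓘(ℝ, F) ∞ (fun a : G => (a : G ⧸ L))) (a : G)
    (X : GroupLieAlgebra 𝓘(ℝ, E) G) :
    differential E F (fun a : G => (a : G ⧸ L)) a (mulInvariantVectorField X a) =
      differential F F (fun y : G ⧸ L => a • y) ((1 : G) : G ⧸ L) (baseDifferential E F L X) := by
  have hd : MDifferentiableAt 𝓘(ℝ, E) 𝓘(ℝ, E) (fun x : G => a * x) 1 :=
    (contMDiff_mul_left (I := 𝓘(ℝ, E)) (n := ∞)).mdifferentiableAt (by simp)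
  have hm : ∀ b : G, MDifferentiableAt 𝓘(ℝ, E) 𝓘(ℝ, F) (fun a : G => (a : G ⧸ L)) b := fun b =>
    hp.contMDiff.mdifferentiableAt (by simp)
  have h1 := differential_comp (hm (a * 1)) hd
  have h2 := differential_comp (x := (1 : G))
    ((contMDiff_smul_quotient hp a).mdifferentiableAt (x := ((1 : G) : G ⧸ L)) (by simp)) (hm 1)
  have h3 : ((fun a : G => (a : G ⧸ L)) ∘ fun x : G => a * x) =
      (fun y : G ⧸ L => a • y) ∘ fun a : G => (a : G ⧸ L) := rfl
  rw [h3, h2, mul_one] at h1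
  exact (congrArg (fun T => T X) h1).symm

omit [IsManifold 𝓘(ℝ, F) ∞ (G ⧸ L)] [ChartedSpace F (G ⧸ L)] in
/-- Left-invariant vector fields span every tangent space. -/
lemma exists_mulInvariantVectorField_eq (a : G) (w : E) :
    ∃ X : GroupLieAlgebra 𝓘(ℝ, E) G, mulInvariantVectorField X a = w := by
  have hd : ∀ a b : G, MDifferentiableAt 𝓘(ℝ, E) 𝓘(ℝ, E) (fun x : G => a * x) b := fun a b =>
    (contMDiff_mul_left (I := 𝓘(ℝ, E)) (n := ∞)).mdifferentiableAt (by simp)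
  refine ⟨differential E E (fun x : G => a⁻¹ * x) a w, ?_⟩
  have h1 := differential_comp (x := a) (hd a (a⁻¹ * a)) (hd a⁻¹ a)
  have h2 : ((fun x : G => a * x) ∘ fun x : G => a⁻¹ * x) = id := by ext x; simp
  rw [h2, differential_id, inv_mul_cancel] at h1
  exact (congrArg (fun T => T w) h1).symm

/-- The projection `G → G/L` kills the Lie algebra of `L`. -/
lemma baseDifferential_eq_zero
    (hp : IsSubmersion 𝓘(ℝ, E) 𝓘(ℝ, F) ∞ (fun a : G => (a : G ⧸ L)))
    {X : GroupLieAlgebra 𝓘(ℝ, E) G} (hX : X ∈ lieAlgebraOf L) : baseDifferential E F L X = 0 := by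
  have hle : (lieAlgebraOf L : Submodule ℝ (GroupLieAlgebra 𝓘(ℝ, E) G)) ≤
      LinearMap.ker (baseDifferential E F L).toLinearMap := by
    refine Submodule.span_le.2 ?_
    rintro X ⟨γ, hγ, hmem⟩
    -- A one-parameter subgroup inside `L` projects to a constant curve, so its initial velocity is
    -- killed; the kernel being a subspace, generators of the span are enough.
    have hc : (fun a : G => (a : G ⧸ L)) ∘ γ = fun _ => ((1 : G) : G ⧸ L) := by
      ext t
      exact QuotientGroup.eq.2 (by simpa using hmem t)
    have h1 := velocity_comp (F := E) (F' := F) (f := fun a : G => (a : G ⧸ L)) (γ := γ) (t := 0)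
      (hp.contMDiff.mdifferentiableAt (by simp))
      ((contMDiff_of_isExpCurve hγ).mdifferentiableAt (by simp))
    have h2 : velocity F (fun _ : ℝ => ((1 : G) : G ⧸ L)) 0 = 0 := by
      rw [velocity, differential, mfderiv_const]; rfl
    rw [hc, h2, velocity_of_isExpCurve hγ, hγ.1,
      differential_mk_mulInvariantVectorField hp] at h1
    have h3 : (fun y : G ⧸ L => (1 : G) • y) = id := by ext y; simp
    rw [h3, differential_id] at h1
    exact h1.symm
  exact hle hX

end Smooth

end Quotient

/-! ### Invariant metrics on `G/L` -/

section HomogeneousMetric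

variable {E F : Type*} [NormedAddCommGroup E] [NormedSpace ℝ E]
  [NormedAddCommGroup F] [NormedSpace ℝ F]
  {G : Type*} [TopologicalSpace G] [ChartedSpace E G] [Group G] [LieGroup 𝓘(ℝ, E) ∞ G]
  {L : Subgroup G} [ChartedSpace F (G ⧸ L)] [IsManifold 𝓘(ℝ, F) ∞ (G ⧸ L)]
  {Q : LinearMap.BilinForm ℝ (GroupLieAlgebra 𝓘(ℝ, E) G)}
  {V : Submodule ℝ (GroupLieAlgebra 𝓘(ℝ, E) G)} {P : Module.End ℝ V}
  {g : SmoothMetric F (G ⧸ L)}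

omit [LieGroup 𝓘(ℝ, E) ∞ G] in
lemma IsMetricOf.tangentNorm_smul (hg : IsMetricOf L Q V P g) (a : G) (x : G ⧸ L) (v : F) :
    tangentNorm g (a • x) (differential F F (fun y : G ⧸ L => a • y) x v) = tangentNorm g x v :=
  congrArg Real.sqrt (hg.invariant a x v v)

omit [LieGroup 𝓘(ℝ, E) ∞ G] in
lemma IsMetricOf.tangentNorm_baseDifferential (hg : IsMetricOf L Q V P g) (X : V) :
    tangentNorm g ((1 : G) : G ⧸ L) (baseDifferential E F L X) = √(Q (P X) X) :=
  congrArg Real.sqrt (hg.inner_eq X X)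

/-- Invariance makes the norm of a projected left-invariant field constant over `G`. Since such
fields span every tangent space of `G/L`, norm comparisons need only be made at the base point. -/
lemma IsMetricOf.tangentNorm_mulInvariantVectorField (hg : IsMetricOf L Q V P g)
    (hp : IsSubmersion 𝓘(ℝ, E) 𝓘(ℝ, F) ∞ (fun a : G => (a : G ⧸ L))) (a : G)
    (X : GroupLieAlgebra 𝓘(ℝ, E) G) :
    tangentNorm g (a : G ⧸ L)
      (differential E F (fun a : G => (a : G ⧸ L)) a (mulInvariantVectorField X a)) =
      tangentNorm g ((1 : G) : G ⧸ L) (baseDifferential E F L X) := by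
  have h1 := hg.tangentNorm_smul a ((1 : G) : G ⧸ L) (baseDifferential E F L X)
  have h2 : a • ((1 : G) : G ⧸ L) = (a : G ⧸ L) :=
    congrArg (fun b : G => (b : G ⧸ L)) (mul_one a)
  rw [differential_mk_mulInvariantVectorField hp, ← h1, h2]

/-- `G` acts by isometries. -/
lemma IsMetricOf.riemannianDistance_smul (hg : IsMetricOf L Q V P g)
    (hp : IsSubmersion 𝓘(ℝ, E) 𝓘(ℝ, F) ∞ (fun a : G => (a : G ⧸ L))) (a : G) (x y : G ⧸ L) :
    riemannianDistance g (a • x) (a • y) = riemannianDistance g x y := by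
  have key : ∀ (a : G) (x y : G ⧸ L),
      riemannianDistance g (a • x) (a • y) ≤ riemannianDistance g x y := by
    intro a x y
    have := riemannianDistance_map_le g g ((contMDiff_smul_quotient hp a).of_le (by simp))
      one_pos (fun x v => by rw [one_mul, hg.tangentNorm_smul a x v]) x y
    simpa using this
  refine (key a x y).antisymm ?_
  simpa using key a⁻¹ (a • x) (a • y)

end HomogeneousMetric

/-! ### Uniform estimates for bilinear forms -/

section Forms

/-- For a positive definite form there is a finite family whose Gram values control every bilinear
form. -/
lemma exists_family_abs_le {V : Type*} [AddCommGroup V] [Module ℝ V] [FiniteDimensional ℝ V]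
    (p : LinearMap.BilinForm ℝ V) (hsymm : ∀ X Y, p X Y = p Y X) (hpos : ∀ X, X ≠ 0 → 0 < p X X) :
    ∃ e : Fin (Module.finrank ℝ V) → V, ∀ (B : LinearMap.BilinForm ℝ V) (X : V),
      |B X X| ≤ (∑ i, ∑ j, |B (e i) (e j)|) * p X X := by
  have hnn : ∀ X, 0 ≤ p X X := fun X => by
    rcases eq_or_ne X 0 with rfl | h
    · simp
    · exact (hpos X h).le
  let core : InnerProductSpace.Core ℝ V :=
    { inner := fun X Y => p X Y
      conj_inner_symm := fun X Y => by simpa using hsymm Y X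
      re_inner_nonneg := fun X => by simpa using hnn X
      add_left := fun X Y Z => by simp
      smul_left := fun X Y r => by simp
      definite := fun X h => by
        by_contra hX
        exact (hpos X hX).ne' h }
  let _ : NormedAddCommGroup V := core.toNormedAddCommGroup
  let _ : InnerProductSpace ℝ V := InnerProductSpace.ofCore core.toCore
  -- For a `p`-orthonormal basis each coordinate of `X` is at most `√(p X X)`, so expanding `B X X`
  -- in coordinates bounds it by its matrix entries.
  let e := stdOrthonormalBasis ℝ V
  refine ⟨e, fun B X => ?_⟩
  have hnorm : ‖X‖ * ‖X‖ = p X X := (real_inner_self_eq_norm_mul_norm X).symm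
  have hcoord : ∀ i, |e.repr X i| ≤ ‖X‖ := fun i => by
    rw [e.repr_apply_apply]
    simpa using abs_real_inner_le_norm (e i) X
  have hB : B X X = ∑ i, ∑ j, e.repr X i * e.repr X j * B (e i) (e j) := by
    conv_lhs => rw [← e.sum_repr X]
    simp only [map_sum, LinearMap.sum_apply, map_smul, LinearMap.smul_apply, smul_eq_mul,
      Finset.mul_sum, mul_assoc]
    exact Finset.sum_comm.trans
      (Finset.sum_congr rfl fun i _ => Finset.sum_congr rfl fun j _ => by ring)
  rw [hB, ← hnorm, Finset.sum_mul]
  refine (Finset.abs_sum_le_sum_abs _ _).trans (Finset.sum_le_sum fun i _ => ?_)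
  rw [Finset.sum_mul]
  refine (Finset.abs_sum_le_sum_abs _ _).trans (Finset.sum_le_sum fun j _ => ?_)
  rw [abs_mul, abs_mul, mul_comm]
  gcongr
  exacts [hcoord i, hcoord j]

/-- Pointwise convergence of bilinear forms is uniform with respect to a positive definite form. -/
lemma eventually_abs_sub_le {V : Type*} [AddCommGroup V] [Module ℝ V] [FiniteDimensional ℝ V]
    (p : LinearMap.BilinForm ℝ V) (hsymm : ∀ X Y, p X Y = p Y X) (hpos : ∀ X, X ≠ 0 → 0 < p X X)
    {b : ℕ → LinearMap.BilinForm ℝ V} {b' : LinearMap.BilinForm ℝ V}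
    (h : ∀ X Y, Tendsto (fun n => b n X Y) atTop (𝓝 (b' X Y))) {ε : ℝ} (hε : 0 < ε) :
    ∀ᶠ n in atTop, ∀ X, |b n X X - b' X X| ≤ ε * p X X := by
  obtain ⟨e, he⟩ := exists_family_abs_le p hsymm hpos
  have hnn : ∀ X, 0 ≤ p X X := fun X => by
    rcases eq_or_ne X 0 with rfl | h
    · simp
    · exact (hpos X h).le
  have h1 : Tendsto (fun n => ∑ i, ∑ j, |(b n - b') (e i) (e j)|) atTop (𝓝 0) := by
    have : (0 : ℝ) = ∑ i : Fin (Module.finrank ℝ V), ∑ j : Fin (Module.finrank ℝ V),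
      |b' (e i) (e j) - b' (e i) (e j)| := by simp
    rw [this]
    exact tendsto_finsetSum _ fun i _ => tendsto_finsetSum _ fun j _ =>
      ((h (e i) (e j)).sub_const _).abs
  filter_upwards [h1.eventually_lt_const hε] with n hn X
  exact (he (b n - b') X).trans (mul_le_mul_of_nonneg_right hn.le (hnn X))

/-- Pointwise convergent sequences of bilinear forms are uniformly bounded with respect to a
positive definite form. -/
lemma exists_forall_le_of_tendsto {V : Type*} [AddCommGroup V] [Module ℝ V] [FiniteDimensional ℝ V]
    (p : LinearMap.BilinForm ℝ V) (hsymm : ∀ X Y, p X Y = p Y X) (hpos : ∀ X, X ≠ 0 → 0 < p X X)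
    {b : ℕ → LinearMap.BilinForm ℝ V} 
    (h : ∀ X Y, ∃ l, Tendsto (fun n => b n X Y) atTop (𝓝 l)) :
    ∃ C > 0, ∀ n X, b n X X ≤ C ^ 2 * p X X := by
  obtain ⟨e, he⟩ := exists_family_abs_le p hsymm hpos
  have hnn : ∀ X, 0 ≤ p X X := fun X => by
    rcases eq_or_ne X 0 with rfl | h
    · simp
    · exact (hpos X h).le
  choose l hl using h
  have h1 : Tendsto (fun n => ∑ i, ∑ j, |b n (e i) (e j)|) atTop
      (𝓝 (∑ i, ∑ j, |l (e i) (e j)|)) :=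
    tendsto_finsetSum _ fun i _ => tendsto_finsetSum _ fun j _ => (hl (e i) (e j)).abs
  obtain ⟨D, hD⟩ := h1.bddAbove_range
  -- `D` bounds the entry sums for all `n`; the constant is chosen so that `D ≤ (|D| + 1) ^ 2`.
  refine ⟨|D| + 1, by positivity, fun n X => (le_abs_self _).trans ((he (b n) X).trans ?_)⟩
  refine mul_le_mul_of_nonneg_right ?_ (hnn X)
  have h2 : ∑ i, ∑ j, |b n (e i) (e j)| ≤ D := hD (mem_range_self n)
  nlinarith [abs_nonneg D, le_abs_self D]

end Forms

/-! ### The projection `G/H → G/K` and its Lipschitz bound -/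

section Projection

variable {E F F' : Type*} [NormedAddCommGroup E] [NormedSpace ℝ E]
  [NormedAddCommGroup F] [NormedSpace ℝ F] [NormedAddCommGroup F'] [NormedSpace ℝ F']
  {G : Type*} [TopologicalSpace G] [ChartedSpace E G] [Group G]

/-- The projection `G/H → G/K`. -/
def projection (H : Subgroup G) (k : Submodule ℝ (GroupLieAlgebra 𝓘(ℝ, E) G)) :
    G ⧸ H → G ⧸ extendedSubgroup H k :=
  Subgroup.quotientMapOfLE le_sup_left

variable {H : Subgroup G} {k : Submodule ℝ (GroupLieAlgebra 𝓘(ℝ, E) G)}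
  [ChartedSpace F (G ⧸ H)] [ChartedSpace F' (G ⧸ extendedSubgroup H k)]

section Smooth

variable [LieGroup 𝓘(ℝ, E) ∞ G] [IsManifold 𝓘(ℝ, F) ∞ (G ⧸ H)]
  [IsManifold 𝓘(ℝ, F') ∞ (G ⧸ extendedSubgroup H k)]

omit [IsManifold 𝓘(ℝ, F') ∞ (G ⧸ extendedSubgroup H k)] in
lemma contMDiff_projection
    (hpM : IsSubmersion 𝓘(ℝ, E) 𝓘(ℝ, F) ∞ (fun a : G => (a : G ⧸ H)))
    (hpN : IsSubmersion 𝓘(ℝ, E) 𝓘(ℝ, F') ∞ (fun a : G => (a : G ⧸ extendedSubgroup H k))) :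
    ContMDiff 𝓘(ℝ, F) 𝓘(ℝ, F') ∞ (projection H k) :=
  contMDiff_of_comp_submersion hpM Quotient.mk_surjective hpN.contMDiff

omit [IsManifold 𝓘(ℝ, F') ∞ (G ⧸ extendedSubgroup H k)] in
lemma differential_projection_mk
    (hpM : IsSubmersion 𝓘(ℝ, E) 𝓘(ℝ, F) ∞ (fun a : G => (a : G ⧸ H)))
    (hpN : IsSubmersion 𝓘(ℝ, E) 𝓘(ℝ, F') ∞ (fun a : G => (a : G ⧸ extendedSubgroup H k)))
    (a : G) (w : E) :
    differential F F' (projection H k) (a : G ⧸ H)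
        (differential E F (fun a : G => (a : G ⧸ H)) a w) =
      differential E F' (fun a : G => (a : G ⧸ extendedSubgroup H k)) a w := by
  have h1 := differential_comp (F := E) (F' := F) (F'' := F') (x := a) (f := projection H k)
    (h := fun a : G => (a : G ⧸ H))
    ((contMDiff_projection hpM hpN).mdifferentiableAt (by simp))
    (hpM.contMDiff.mdifferentiableAt (by simp))
  exact (congrArg (fun T => T w) h1).symm

-- The point `γ t` is the time-one value of the one-parameter subgroup of `t • X`, hence one of the
-- generators of `K`.
omit [ChartedSpace F (G ⧸ H)] [ChartedSpace F' (G ⧸ extendedSubgroup H k)]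
  [IsManifold 𝓘(ℝ, F) ∞ (G ⧸ H)] [IsManifold 𝓘(ℝ, F') ∞ (G ⧸ extendedSubgroup H k)]
  [LieGroup 𝓘(ℝ, E) ∞ G] in
lemma IsExpCurve.mem_extendedSubgroup {X : GroupLieAlgebra 𝓘(ℝ, E) G} (hX : X ∈ k)
    {γ : ℝ → G} (hγ : IsExpCurve X γ) (t : ℝ) : γ t ∈ extendedSubgroup H k :=
  Subgroup.mem_sup_right (Subgroup.subset_closure
    ⟨t • X, k.smul_mem t hX, _, hγ.comp_mul t, by simp⟩)

/-- Together with `baseDifferential_eq_zero`, this says that all of `k` is vertical for `G → G/K`.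
-/
lemma le_lieAlgebraOf_extendedSubgroup [FiniteDimensional ℝ E] [T2Space G] :
    k ≤ lieAlgebraOf (extendedSubgroup H k) := by
  intro X hX
  obtain ⟨γ, hγ⟩ := exists_isExpCurve X
  exact Submodule.subset_span ⟨γ, hγ, hγ.mem_extendedSubgroup hX⟩

end Smooth

section Forms

variable {Q : LinearMap.BilinForm ℝ (GroupLieAlgebra 𝓘(ℝ, E) G)}

omit [ChartedSpace F (G ⧸ H)] [ChartedSpace F' (G ⧸ extendedSubgroup H k)] in
lemma orthogonal_le_orthogonal (hk : IsToralSubalgebra H k) :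
    Q.orthogonal k ≤ Q.orthogonal (lieAlgebraOf H) :=
  fun _ hX Y hY => hX Y (hk.lie_lt.le hY)

-- This is the splitting of `k` into `h` and `t`: the `h`-part is invisible in `G/H`, and what
-- remains lies where the metrics tend to zero.
omit [ChartedSpace F (G ⧸ H)] [ChartedSpace F' (G ⧸ extendedSubgroup H k)] in
lemma exists_vertical_part [FiniteDimensional ℝ E] (hQ : IsAdInvariantInner Q)
    (hk : IsToralSubalgebra H k) {X : GroupLieAlgebra 𝓘(ℝ, E) G} (hX : X ∈ k) :
    ∃ T : Q.orthogonal (lieAlgebraOf H), (T : GroupLieAlgebra 𝓘(ℝ, E) G) ∈ k ∧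
      X - T ∈ lieAlgebraOf H := by
  have : FiniteDimensional ℝ (GroupLieAlgebra 𝓘(ℝ, E) G) := ‹FiniteDimensional ℝ E›
  obtain ⟨Y, hY, T, hT, rfl⟩ := exists_add_mem_orthogonal hQ.symm hQ.pos (lieAlgebraOf H) X
  refine ⟨⟨T, hT⟩, ?_, by simpa using hY⟩
  exact (k.add_mem_iff_right (hk.lie_lt.le hY)).1 hX

omit [ChartedSpace F (G ⧸ H)] [ChartedSpace F' (G ⧸ extendedSubgroup H k)] in
/-- A submersion metric is the orthogonal sum of its vertical and horizontal parts. -/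
lemma IsSubmersionMetric.form_add (hQ : IsAdInvariantInner Q)
    {P : Module.End ℝ (Q.orthogonal (lieAlgebraOf H))} (hP : IsSubmersionMetric Q H k P)
    {T N : Q.orthogonal (lieAlgebraOf H)} (hT : (T : GroupLieAlgebra 𝓘(ℝ, E) G) ∈ k)
    (hN : (N : GroupLieAlgebra 𝓘(ℝ, E) G) ∈ Q.orthogonal k) :
    Q (P (T + N)) ((T + N : Q.orthogonal (lieAlgebraOf H)) : GroupLieAlgebra 𝓘(ℝ, E) G) =
      Q (P T) T + Q (P N) N := by
  have h1 : Q (P T) N = 0 := hN _ (hP.map_t T hT)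
  have h2 : Q (P N) T = 0 := by
    rw [hQ.symm]
    exact hP.map_n N hN _ hT
  simp [h1, h2]

end Forms

section Metric

variable [LieGroup 𝓘(ℝ, E) ∞ G] [FiniteDimensional ℝ E] [T2Space G] [IsManifold 𝓘(ℝ, F) ∞ (G ⧸ H)]
  [IsManifold 𝓘(ℝ, F') ∞ (G ⧸ extendedSubgroup H k)]
  {Q : LinearMap.BilinForm ℝ (GroupLieAlgebra 𝓘(ℝ, E) G)}

/-- Square roots of comparable numbers are comparable. -/
lemma sqrt_le_mul_sqrt {x y c : ℝ} (hc : 0 ≤ c) (h : x ≤ c ^ 2 * y) : √x ≤ c * √y := by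
  rw [← Real.sqrt_sq hc, ← Real.sqrt_mul (sq_nonneg c)]
  exact Real.sqrt_le_sqrt h

/-- Splitting of a Lie algebra element into a part tangent to `H`, a vertical and a horizontal part,
seen in both quotients. -/
lemma exists_base_decomposition (hQ : IsAdInvariantInner Q) (hk : IsToralSubalgebra H k)
    (hpM : IsSubmersion 𝓘(ℝ, E) 𝓘(ℝ, F) ∞ (fun a : G => (a : G ⧸ H)))
    (hpN : IsSubmersion 𝓘(ℝ, E) 𝓘(ℝ, F') ∞ (fun a : G => (a : G ⧸ extendedSubgroup H k)))
    (X : GroupLieAlgebra 𝓘(ℝ, E) G) :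
    ∃ T N : Q.orthogonal (lieAlgebraOf H), (T : GroupLieAlgebra 𝓘(ℝ, E) G) ∈ k ∧
      (N : GroupLieAlgebra 𝓘(ℝ, E) G) ∈ Q.orthogonal k ∧
      X - N ∈ k ∧
      baseDifferential E F H X = baseDifferential E F H (T + N : Q.orthogonal (lieAlgebraOf H)) ∧
      baseDifferential E F' (extendedSubgroup H k) X =
        baseDifferential E F' (extendedSubgroup H k) N := by
  have : FiniteDimensional ℝ (GroupLieAlgebra 𝓘(ℝ, E) G) := ‹FiniteDimensional ℝ E›
  obtain ⟨U, hU, N, hN, rfl⟩ := exists_add_mem_orthogonal hQ.symm hQ.pos k X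
  obtain ⟨T, hT, hUT⟩ := exists_vertical_part (Q := Q) hQ hk hU
  refine ⟨T, ⟨N, orthogonal_le_orthogonal hk hN⟩, hT, hN, by simpa using hU, ?_, ?_⟩
  · rw [← sub_eq_zero, ← map_sub]
    exact baseDifferential_eq_zero hpM (by simpa using hUT)
  · rw [map_add, baseDifferential_eq_zero hpN (le_lieAlgebraOf_extendedSubgroup hU), zero_add]

/-- The projection `G/H → G/K` is `c`-Lipschitz if it is so on horizontal vectors. -/
lemma riemannianDistance_projection_le (hQ : IsAdInvariantInner Q) (hk : IsToralSubalgebra H k)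
    (hpM : IsSubmersion 𝓘(ℝ, E) 𝓘(ℝ, F) ∞ (fun a : G => (a : G ⧸ H)))
    (hpN : IsSubmersion 𝓘(ℝ, E) 𝓘(ℝ, F') ∞ (fun a : G => (a : G ⧸ extendedSubgroup H k)))
    {P : Module.End ℝ (Q.orthogonal (lieAlgebraOf H))} (hP : IsSubmersionMetric Q H k P)
    {P' : Module.End ℝ (Q.orthogonal k)}
    {gM : SmoothMetric F (G ⧸ H)} (hgM : IsMetricOf H Q (Q.orthogonal (lieAlgebraOf H)) P gM)
    {gN : SmoothMetric F' (G ⧸ extendedSubgroup H k)}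
    (hgN : IsMetricOf (extendedSubgroup H k) Q (Q.orthogonal k) P' gN)
    {c : ℝ} (hc : 0 < c)
    (hle : ∀ (X : Q.orthogonal (lieAlgebraOf H)) (Y : Q.orthogonal k),
      (X : GroupLieAlgebra 𝓘(ℝ, E) G) = Y → Q (P' Y) Y ≤ c ^ 2 * Q (P X) X) (x y : G ⧸ H) :
    riemannianDistance gN (projection H k x) (projection H k y) ≤
      ENNReal.ofReal c * riemannianDistance gM x y := by
  refine riemannianDistance_map_le gM gN ((contMDiff_projection hpM hpN).of_le (by simp)) hc
    (fun x v => ?_) x y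
  obtain ⟨a, rfl⟩ := Quotient.mk_surjective x
  obtain ⟨w, rfl⟩ := differential_surjective_of_submersion hpM a v
  obtain ⟨X, rfl⟩ := exists_mulInvariantVectorField_eq a w
  change tangentNorm gN (a : G ⧸ extendedSubgroup H k)
    (differential F F' (projection H k) (a : G ⧸ H) _) ≤ c * tangentNorm gM (a : G ⧸ H) _
  refine ((congrArg (tangentNorm gN (a : G ⧸ extendedSubgroup H k))
    (differential_projection_mk hpM hpN a _)).trans
      (hgN.tangentNorm_mulInvariantVectorField hpN a X)).trans_le ?_
  rw [hgM.tangentNorm_mulInvariantVectorField hpM]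
  obtain ⟨T, N, hT, hN, -, h1, h2⟩ := exists_base_decomposition hQ hk hpM hpN X
  have h3 := hgN.tangentNorm_baseDifferential ⟨N, hN⟩
  have h4 := hgM.tangentNorm_baseDifferential (T + N)
  rw [h1, h2, h3, h4, hP.form_add hQ hT hN]
  refine sqrt_le_mul_sqrt hc.le ((hle N ⟨N, hN⟩ rfl).trans ?_)
  -- The vertical term is present only in `G/H`, and its sign lets it be discarded.
  have h5 : 0 ≤ Q (P T) T := by
    rcases eq_or_ne T 0 with rfl | h
    · simp
    · exact (hP.isInvariantMetricEndo.pos T h).le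
  gcongr
  linarith

omit [T2Space G] in
/-- Comparison of two invariant metrics on `G/H`. -/
lemma riemannianDistance_le_mul {L : Subgroup G} [ChartedSpace F (G ⧸ L)]
    [IsManifold 𝓘(ℝ, F) ∞ (G ⧸ L)] (hQ : IsAdInvariantInner Q)
    (hpM : IsSubmersion 𝓘(ℝ, E) 𝓘(ℝ, F) ∞ (fun a : G => (a : G ⧸ L)))
    {P P' : Module.End ℝ (Q.orthogonal (lieAlgebraOf L))}
    {g g' : SmoothMetric F (G ⧸ L)} (hg : IsMetricOf L Q (Q.orthogonal (lieAlgebraOf L)) P g)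
    (hg' : IsMetricOf L Q (Q.orthogonal (lieAlgebraOf L)) P' g') {c : ℝ} (hc : 0 < c)
    (hle : ∀ X : Q.orthogonal (lieAlgebraOf L), Q (P' X) X ≤ c ^ 2 * Q (P X) X) (x y : G ⧸ L) :
    riemannianDistance g' x y ≤ ENNReal.ofReal c * riemannianDistance g x y := by
  have : FiniteDimensional ℝ (GroupLieAlgebra 𝓘(ℝ, E) G) := ‹FiniteDimensional ℝ E›
  refine riemannianDistance_map_le g g' (f := id) contMDiff_id hc (fun x v => ?_) x y
  rw [differential_id]
  obtain ⟨a, rfl⟩ := Quotient.mk_surjective x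
  obtain ⟨w, rfl⟩ := differential_surjective_of_submersion hpM a v
  obtain ⟨X, rfl⟩ := exists_mulInvariantVectorField_eq a w
  change tangentNorm g' (a : G ⧸ L) _ ≤ c * tangentNorm g (a : G ⧸ L) _
  rw [ContinuousLinearMap.id_apply, hg.tangentNorm_mulInvariantVectorField hpM,
    hg'.tangentNorm_mulInvariantVectorField hpM]
  obtain ⟨U, hU, N, hN, rfl⟩ := exists_add_mem_orthogonal hQ.symm hQ.pos (lieAlgebraOf L) X
  rw [map_add, baseDifferential_eq_zero hpM hU, zero_add]
  have h3 := hg.tangentNorm_baseDifferential ⟨N, hN⟩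
  have h4 := hg'.tangentNorm_baseDifferential ⟨N, hN⟩
  rw [h3, h4]
  exact sqrt_le_mul_sqrt hc.le (hle _)

end Metric

end Projection

/-! ### Lifting curves from `G/K` to `G/H` -/

section Product

variable {E : Type*} [NormedAddCommGroup E] [NormedSpace ℝ E]
  {G : Type*} [TopologicalSpace G] [ChartedSpace E G] [Group G] [LieGroup 𝓘(ℝ, E) ∞ G]

/-- The product rule for two curves in a Lie group, the second one passing through `1`. -/
lemma velocity_mul {γ β : ℝ → G} {t : ℝ} (hγ : MDifferentiableAt 𝓘(ℝ, ℝ) 𝓘(ℝ, E) γ t)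
    (hβ : MDifferentiableAt 𝓘(ℝ, ℝ) 𝓘(ℝ, E) β t) (h1 : β t = 1) :
    velocity E (fun s => γ s * β s) t =
      velocity E γ t + differential E E (fun x : G => γ t * x) 1 (velocity E β t) := by
  have hm : MDifferentiableAt (𝓘(ℝ, E).prod 𝓘(ℝ, E)) 𝓘(ℝ, E) (fun p : G × G => p.1 * p.2)
      (γ t, β t) := (contMDiff_mul 𝓘(ℝ, E) ∞).mdifferentiableAt (by simp)
  have h2 := hm.hasMFDerivAt.comp t (hγ.hasMFDerivAt.prodMk hβ.hasMFDerivAt)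
  have h3 := congrArg (fun T : ℝ →L[ℝ] E => T 1) h2.mfderiv
  refine h3.trans ((mfderiv_prod_eq_add_apply hm).trans ?_)
  -- Since `β t = 1`, right translation by `β t` is the identity and leaves the velocity of `γ`
  -- unchanged.
  have h4 : (fun z : G => z * β t) = id := by ext z; simp [h1]
  change differential E E (fun z : G => z * β t) (γ t) (velocity E γ t) +
    differential E E (fun z : G => γ t * z) (β t) (velocity E β t) = _
  rw [h4, differential_id, h1]
  rfl

end Product

section Lift

variable {E F F' : Type*} [NormedAddCommGroup E] [NormedSpace ℝ E]
  [NormedAddCommGroup F] [NormedSpace ℝ F] [NormedAddCommGroup F'] [NormedSpace ℝ F']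
  {G : Type*} [TopologicalSpace G] [ChartedSpace E G] [Group G]
  {H : Subgroup G} {k : Submodule ℝ (GroupLieAlgebra 𝓘(ℝ, E) G)}
  [ChartedSpace F (G ⧸ H)] [ChartedSpace F' (G ⧸ extendedSubgroup H k)]
  [LieGroup 𝓘(ℝ, E) ∞ G] [FiniteDimensional ℝ E] [T2Space G] [IsManifold 𝓘(ℝ, F) ∞ (G ⧸ H)]
  [IsManifold 𝓘(ℝ, F') ∞ (G ⧸ extendedSubgroup H k)]
  {Q : LinearMap.BilinForm ℝ (GroupLieAlgebra 𝓘(ℝ, E) G)}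

/-- Every `C¹` curve of `G/K` lifts locally to a `C¹` curve of `G/H` whose speed at one given time
is controlled by the speed of the original curve. -/
lemma exists_lift_speed_le (hQ : IsAdInvariantInner Q) (hk : IsToralSubalgebra H k)
    (hpM : IsSubmersion 𝓘(ℝ, E) 𝓘(ℝ, F) ∞ (fun a : G => (a : G ⧸ H)))
    (hpN : IsSubmersion 𝓘(ℝ, E) 𝓘(ℝ, F') ∞ (fun a : G => (a : G ⧸ extendedSubgroup H k)))
    {P : Module.End ℝ (Q.orthogonal (lieAlgebraOf H))}
    {P' : Module.End ℝ (Q.orthogonal k)}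
    {gM : SmoothMetric F (G ⧸ H)} (hgM : IsMetricOf H Q (Q.orthogonal (lieAlgebraOf H)) P gM)
    {gN : SmoothMetric F' (G ⧸ extendedSubgroup H k)}
    (hgN : IsMetricOf (extendedSubgroup H k) Q (Q.orthogonal k) P' gN)
    {c : ℝ} (hc : 0 < c)
    (hle : ∀ (X : Q.orthogonal (lieAlgebraOf H)) (Y : Q.orthogonal k),
      (X : GroupLieAlgebra 𝓘(ℝ, E) G) = Y → Q (P X) X ≤ c ^ 2 * Q (P' Y) Y)
    {γ : ℝ → G ⧸ extendedSubgroup H k} {t : ℝ} (hγ : ContMDiffAt 𝓘(ℝ, ℝ) 𝓘(ℝ, F') 1 γ t)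
    {y : G ⧸ H} (hy : projection H k y = γ t) :
    ∃ η : ℝ → G ⧸ H, η t = y ∧ ContMDiffAt 𝓘(ℝ, ℝ) 𝓘(ℝ, F) 1 η t ∧
      (∀ᶠ s in 𝓝 t, projection H k (η s) = γ s) ∧ speed gM η t ≤ c * speed gN γ t := by
  obtain ⟨a, rfl⟩ := Quotient.mk_surjective y
  change (a : G ⧸ extendedSubgroup H k) = γ t at hy
  obtain ⟨σ, hσ0, hσ, hsec⟩ := exists_local_section hpN a
  simp only [hy] at hσ0 hσ hsec
  have hα : ContMDiffAt 𝓘(ℝ, ℝ) 𝓘(ℝ, E) 1 (σ ∘ γ) t := (hσ.of_le (by simp)).comp t hγ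
  have hα0 : (σ ∘ γ) t = a := hσ0
  have hsecγ : ∀ᶠ s in 𝓝 t, ((σ (γ s) : G) : G ⧸ extendedSubgroup H k) = γ s :=
    hγ.continuousAt.eventually hsec
  obtain ⟨X, hX⟩ := exists_mulInvariantVectorField_eq a (velocity E (σ ∘ γ) t)
  obtain ⟨T, N, hT, hN, hXN, -, h2⟩ := exists_base_decomposition hQ hk hpM hpN X
  set U : GroupLieAlgebra 𝓘(ℝ, E) G := X - (N : GroupLieAlgebra 𝓘(ℝ, E) G) with hU
  -- Multiplying the lift `σ ∘ γ` on the right by `exp (-(s - t) U)`, a curve in `K`, does not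
  -- change its image in `G/K`. At time `t` it cancels the component `U ∈ k` of the velocity and
  -- leaves the horizontal part `N`.
  obtain ⟨β₀, hβ₀⟩ := exists_isExpCurve (-U)
  let β : ℝ → G := β₀ ∘ (· + -t)
  have hβ0 : β t = 1 := by simp [β, hβ₀.1]
  have hβ : IsMIntegralCurve (I := 𝓘(ℝ, E)) β (mulInvariantVectorField (-U)) :=
    hβ₀.2.comp_add (-t)
  have hβK : ∀ s, β s ∈ extendedSubgroup H k := fun s =>
    hβ₀.mem_extendedSubgroup (k.neg_mem hXN) _
  have hβc : ContMDiff 𝓘(ℝ, ℝ) 𝓘(ℝ, E) 1 β :=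
    contMDiff_of_isMIntegralCurve (contMDiff_one_mulInvariantVectorField _).continuous hβ
  have hαβ : ContMDiffAt 𝓘(ℝ, ℝ) 𝓘(ℝ, E) 1 (fun s => (σ ∘ γ) s * β s) t := by
    have : LieGroup 𝓘(ℝ, E) 1 G := LieGroup.of_le (n := ∞) (by simp)
    exact hα.mul hβc.contMDiffAt
  have hvel : velocity E (fun s => (σ ∘ γ) s * β s) t =
      mulInvariantVectorField (N : GroupLieAlgebra 𝓘(ℝ, E) G) a := by
    rw [velocity_mul (hα.mdifferentiableAt (by simp)) (hβc.mdifferentiableAt (by simp)) hβ0,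
      velocity_of_isMIntegralCurve hβ, hβ0, hα0, ← hX]
    have h3 := differential_mul_left_mulInvariantVectorField a 1 (-U)
    rw [mul_one] at h3
    refine (congrArg ((fun v w : E => v + w) (mulInvariantVectorField X a)) h3).trans ?_
    refine ((differential E E (fun x : G => a * x) 1).map_add X (-U)).symm.trans ?_
    refine congrArg (differential E E (fun x : G => a * x) 1) ?_
    exact (congrArg (fun w => X + -w) hU).trans (by abel)
  have hspM := velocity_comp (F := E) (F' := F) (f := fun a : G => (a : G ⧸ H))
    (γ := fun s => (σ ∘ γ) s * β s) (t := t) (hpM.contMDiff.mdifferentiableAt (by simp))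
    (hαβ.mdifferentiableAt (by simp))
  have hspN := velocity_comp (F := E) (F' := F') (f := fun a : G => (a : G ⧸ extendedSubgroup H k))
    (γ := σ ∘ γ) (t := t) (hpN.contMDiff.mdifferentiableAt (by simp))
    (hα.mdifferentiableAt (by simp))
  have hγeq : γ =ᶠ[𝓝 t] (fun a : G => (a : G ⧸ extendedSubgroup H k)) ∘ (σ ∘ γ) := by
    filter_upwards [hsecγ] with s hs using hs.symm
  have hta : (σ ∘ γ) t * β t = a := by rw [hα0, hβ0, mul_one]
  refine ⟨(fun a : G => (a : G ⧸ H)) ∘ fun s => (σ ∘ γ) s * β s, ?_, ?_, ?_, ?_⟩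
  · exact congrArg (fun a : G => (a : G ⧸ H)) hta
  · exact (hpM.contMDiff.of_le (by simp)).contMDiffAt.comp t hαβ
  · filter_upwards [hsecγ] with s hs
    rw [← hs]
    exact QuotientGroup.eq.2 (by simpa using hβK s)
  · have e1 : speed gM ((fun a : G => (a : G ⧸ H)) ∘ fun s => (σ ∘ γ) s * β s) t =
        tangentNorm gM ((1 : G) : G ⧸ H) (baseDifferential E F H N) := by
      rw [speed, hspM, hvel, ← hgM.tangentNorm_mulInvariantVectorField hpM a]
      simp only [Function.comp_apply] at hta ⊢
      rw [hta]
    have e2 : speed gN γ t =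
        tangentNorm gN ((1 : G) : G ⧸ extendedSubgroup H k)
          (baseDifferential E F' (extendedSubgroup H k) X) := by
      rw [← hgN.tangentNorm_mulInvariantVectorField hpN a, hX, speed, velocity,
        differential_congr hγeq, ← hy]
      rw [velocity, hα0] at hspN
      exact congrArg _ hspN
    rw [e1, e2, h2]
    have h3 := hgN.tangentNorm_baseDifferential ⟨N, hN⟩
    have h4 := hgM.tangentNorm_baseDifferential N
    rw [h3, h4]
    exact sqrt_le_mul_sqrt hc.le (hle N ⟨N, hN⟩ rfl)

end Lift

lemma lintegral_Icc_ofReal_eq {φ : ℝ → ℝ} (hφ : Continuous φ) (h0 : ∀ t, 0 ≤ φ t) {a b : ℝ}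
    (hab : a ≤ b) :
    ∫⁻ t in Icc a b, ENNReal.ofReal (φ t) = ENNReal.ofReal (∫ t in a..b, φ t) := by
  rw [intervalIntegral.integral_of_le hab, ← MeasureTheory.integral_Icc_eq_integral_Ioc,
    MeasureTheory.ofReal_integral_eq_lintegral_ofReal
      (hφ.continuousOn.integrableOn_compact isCompact_Icc) (Eventually.of_forall h0)]

section Lift

variable {E F F' : Type*} [NormedAddCommGroup E] [NormedSpace ℝ E]
  [NormedAddCommGroup F] [NormedSpace ℝ F] [NormedAddCommGroup F'] [NormedSpace ℝ F']
  {G : Type*} [TopologicalSpace G] [ChartedSpace E G] [Group G]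
  {H : Subgroup G} {k : Submodule ℝ (GroupLieAlgebra 𝓘(ℝ, E) G)}
  [ChartedSpace F (G ⧸ H)] [ChartedSpace F' (G ⧸ extendedSubgroup H k)]
  [LieGroup 𝓘(ℝ, E) ∞ G] [FiniteDimensional ℝ E] [T2Space G] [IsManifold 𝓘(ℝ, F) ∞ (G ⧸ H)]
  [IsManifold 𝓘(ℝ, F') ∞ (G ⧸ extendedSubgroup H k)]
  {Q : LinearMap.BilinForm ℝ (GroupLieAlgebra 𝓘(ℝ, E) G)}

/-- Short pieces of a `C¹` curve of `G/K` lift to `G/H` with controlled endpoint distance. -/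
lemma eventually_exists_lift (hQ : IsAdInvariantInner Q) (hk : IsToralSubalgebra H k)
    (hpM : IsSubmersion 𝓘(ℝ, E) 𝓘(ℝ, F) ∞ (fun a : G => (a : G ⧸ H)))
    (hpN : IsSubmersion 𝓘(ℝ, E) 𝓘(ℝ, F') ∞ (fun a : G => (a : G ⧸ extendedSubgroup H k)))
    {P : Module.End ℝ (Q.orthogonal (lieAlgebraOf H))}
    {P' : Module.End ℝ (Q.orthogonal k)}
    {gM : SmoothMetric F (G ⧸ H)} (hgM : IsMetricOf H Q (Q.orthogonal (lieAlgebraOf H)) P gM)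
    {gN : SmoothMetric F' (G ⧸ extendedSubgroup H k)}
    (hgN : IsMetricOf (extendedSubgroup H k) Q (Q.orthogonal k) P' gN)
    {c : ℝ} (hc : 0 < c)
    (hle : ∀ (X : Q.orthogonal (lieAlgebraOf H)) (Y : Q.orthogonal k),
      (X : GroupLieAlgebra 𝓘(ℝ, E) G) = Y → Q (P X) X ≤ c ^ 2 * Q (P' Y) Y)
    {γ : ℝ → G ⧸ extendedSubgroup H k} (hγ : ContMDiff 𝓘(ℝ, ℝ) 𝓘(ℝ, F') 1 γ) (t : ℝ)
    {y : G ⧸ H} (hy : projection H k y = γ t) {ε : ℝ} (hε : 0 < ε) :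
    ∀ᶠ s in 𝓝[>] t, ∃ z, projection H k z = γ s ∧
      riemannianDistance gM y z ≤ ENNReal.ofReal (∫ u in t..s, (c * speed gN γ u + ε)) := by
  have hsp : Continuous (speed gN γ) :=
    continuous_iff_continuousAt.2 fun u => continuousAt_speed gN hγ.contMDiffAt
  have hφ : Continuous fun u => c * speed gN γ u + ε := by fun_prop
  have hφ0 : ∀ u, 0 ≤ c * speed gN γ u + ε := fun u =>
    add_nonneg (mul_nonneg hc.le (speed_nonneg _ _ _)) hε.le
  have : IsManifold 𝓘(ℝ, F) 1 (G ⧸ H) := IsManifold.of_le (n := ∞) (by simp)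
  obtain ⟨η, rfl, hη, hproj, hspeed⟩ :=
    exists_lift_speed_le hQ hk hpM hpN hgM hgN hc hle hγ.contMDiffAt hy
  -- The speed bound is known only at time `t`; the slack `ε` makes it strict there, so continuity
  -- extends it to nearby times.
  have h1 : ∀ᶠ u in 𝓝 t, speed gM η u < c * speed gN γ u + ε :=
    (continuousAt_speed gM hη).eventually_lt hφ.continuousAt (hspeed.trans_lt (by linarith))
  have h2 : ∀ᶠ u in 𝓝 t, ContMDiffAt 𝓘(ℝ, ℝ) 𝓘(ℝ, F) 1 η u := by
    obtain ⟨u, hu, hηu⟩ := (contMDiffAt_iff_contMDiffOn_nhds (by simp)).1 hη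
    filter_upwards [eventually_mem_nhds_iff.2 hu] with s hs using hηu.contMDiffAt hs
  obtain ⟨δ, hδ, hball⟩ := Metric.eventually_nhds_iff_ball.1 (h1.and (h2.and hproj))
  filter_upwards [Ioo_mem_nhdsGT (show t < t + δ by linarith)] with s hs
  have hmem : ∀ u ∈ Icc t s, u ∈ Metric.ball t δ := fun u hu => by
    rw [Real.ball_eq_Ioo]
    exact ⟨by linarith [hu.1], hu.2.trans_lt hs.2⟩
  refine ⟨η s, (hball s (hmem s ⟨hs.1.le, le_rfl⟩)).2.2, ?_⟩
  refine (riemannianDistance_le_lintegral_speed gM hs.1.le fun u hu =>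
    (hball u (hmem u hu)).2.1.contMDiffWithinAt).trans ?_
  rw [← lintegral_Icc_ofReal_eq hφ hφ0 hs.1.le]
  exact MeasureTheory.setLIntegral_mono' measurableSet_Icc fun u hu =>
    ENNReal.ofReal_le_ofReal (hball u (hmem u hu)).1.le

/-- Points of `G/H` can be moved to any fibre of `G/H → G/K` at a cost controlled by the distance in
`G/K`. -/
lemma exists_projection_eq_riemannianDistance_le [CompactSpace (G ⧸ H)] [T2Space (G ⧸ H)]
    [T2Space (G ⧸ extendedSubgroup H k)] (hQ : IsAdInvariantInner Q)
    (hk : IsToralSubalgebra H k)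
    (hpM : IsSubmersion 𝓘(ℝ, E) 𝓘(ℝ, F) ∞ (fun a : G => (a : G ⧸ H)))
    (hpN : IsSubmersion 𝓘(ℝ, E) 𝓘(ℝ, F') ∞ (fun a : G => (a : G ⧸ extendedSubgroup H k)))
    {P : Module.End ℝ (Q.orthogonal (lieAlgebraOf H))}
    {P' : Module.End ℝ (Q.orthogonal k)}
    {gM : SmoothMetric F (G ⧸ H)} (hgM : IsMetricOf H Q (Q.orthogonal (lieAlgebraOf H)) P gM)
    {gN : SmoothMetric F' (G ⧸ extendedSubgroup H k)}
    (hgN : IsMetricOf (extendedSubgroup H k) Q (Q.orthogonal k) P' gN)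
    {c : ℝ} (hc : 0 < c)
    (hle : ∀ (X : Q.orthogonal (lieAlgebraOf H)) (Y : Q.orthogonal k),
      (X : GroupLieAlgebra 𝓘(ℝ, E) G) = Y → Q (P X) X ≤ c ^ 2 * Q (P' Y) Y)
    (x : G ⧸ H) (q : G ⧸ extendedSubgroup H k) {r : ℝ}
    (hr : riemannianDistance gN (projection H k x) q < ENNReal.ofReal r) :
    ∃ z, projection H k z = q ∧ riemannianDistance gM x z ≤ ENNReal.ofReal (c * r) := by
  obtain ⟨γ, hγ0, rfl, hγ, hlen⟩ := exists_lintegral_speed_lt gN hr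
  have hsp : Continuous (speed gN γ) :=
    continuous_iff_continuousAt.2 fun u => continuousAt_speed gN hγ.contMDiffAt
  rw [lintegral_Icc_ofReal_eq hsp (fun u => speed_nonneg _ _ _) zero_le_one] at hlen
  set ℓ := ∫ u in (0 : ℝ)..1, speed gN γ u with hℓ
  have hlr : ℓ < r := (ENNReal.ofReal_lt_ofReal_iff_of_nonneg
    (intervalIntegral.integral_nonneg zero_le_one fun u _ => speed_nonneg _ _ _)).1 hlen
  -- The slack is chosen so that the total cost over `[0, 1]` is `c * ℓ + ε = c * r`.
  set ε := c * (r - ℓ) with hεdef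
  have hε : 0 < ε := mul_pos hc (sub_pos.2 hlr)
  set φ : ℝ → ℝ := fun u => c * speed gN γ u + ε with hφdef
  have hφ : Continuous φ := by fun_prop
  have hφ0 : ∀ u, 0 ≤ φ u := fun u =>
    add_nonneg (mul_nonneg hc.le (speed_nonneg _ _ _)) hε.le
  have hφi : ∀ a b, IntervalIntegrable φ MeasureTheory.volume a b := fun a b =>
    hφ.intervalIntegrable a b
  let Λ : ℝ → ℝ := fun t => ∫ u in (0 : ℝ)..t, φ u
  have hΛ : Continuous Λ := intervalIntegral.continuous_primitive hφi 0
  -- Continuous induction over the times at which the fibre of `γ t` is reachable from `x` within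
  -- the allotted cost. Only endpoints and distances are recorded, so the local lifts need not be
  -- glued smoothly.
  let S : Set ℝ := {t | ∃ z, projection H k z = γ t ∧
    riemannianDistance gM x z ≤ ENNReal.ofReal (Λ t)}
  have hclosed : IsClosed (S ∩ Icc 0 1) := by
    -- Pairs of a time and an admissible endpoint form a compact set because `G/H` is compact; its
    -- projection to the time axis is therefore closed.
    let Z : Set (ℝ × (G ⧸ H)) := {p | p.1 ∈ Icc (0 : ℝ) 1 ∧ projection H k p.2 = γ p.1 ∧
      riemannianDistance gM x p.2 ≤ ENNReal.ofReal (Λ p.1)}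
    have hZ : IsClosed Z := by
      refine (isClosed_Icc.preimage continuous_fst).inter (IsClosed.inter ?_ ?_)
      · exact isClosed_eq ((contMDiff_projection hpM hpN).continuous.comp continuous_snd)
          (hγ.continuous.comp continuous_fst)
      · exact isClosed_le ((continuous_riemannianDistance gM x).comp continuous_snd)
          (ENNReal.continuous_ofReal.comp (hΛ.comp continuous_fst))
    have hZc : IsCompact Z :=
      (isCompact_Icc.prod isCompact_univ).of_isClosed_subset hZ fun p hp => ⟨hp.1, mem_univ _⟩
    have himg : S ∩ Icc 0 1 = Prod.fst '' Z := by
      ext t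
      constructor
      · rintro ⟨⟨z, hz⟩, ht⟩
        exact ⟨(t, z), ⟨ht, hz⟩, rfl⟩
      · rintro ⟨⟨t, z⟩, ⟨ht, hz⟩, rfl⟩
        exact ⟨⟨z, hz⟩, ht⟩
    rw [himg]
    exact (hZc.image continuous_fst).isClosed
  have hS0 : (0 : ℝ) ∈ S := ⟨x, hγ0.symm, by simp [riemannianDistance_self]⟩
  have hsub : Icc (0 : ℝ) 1 ⊆ S := by
    refine hclosed.Icc_subset_of_forall_exists_gt hS0 ?_
    rintro t ⟨⟨y, hy, hyd⟩, ht⟩ b hb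
    obtain ⟨s, ⟨z, hz, hzd⟩, hs⟩ :=
      ((eventually_exists_lift hQ hk hpM hpN hgM hgN hc hle hγ t hy hε).and
        (Ioc_mem_nhdsGT hb)).exists
    refine ⟨s, ⟨z, hz, (riemannianDistance_triangle gM x y z).trans ?_⟩, hs⟩
    refine (add_le_add hyd hzd).trans_eq ?_
    rw [← ENNReal.ofReal_add
      (intervalIntegral.integral_nonneg ht.1 fun u _ => hφ0 u)
      (intervalIntegral.integral_nonneg hs.1.le fun u _ => hφ0 u)]
    exact congrArg _ (intervalIntegral.integral_add_adjacent_intervals (hφi 0 t) (hφi t s))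
  obtain ⟨z, hz, hzd⟩ := hsub ⟨zero_le_one, le_rfl⟩
  refine ⟨z, hz, hzd.trans_eq (congrArg _ ?_)⟩
  have : Λ 1 = c * ℓ + ε := by
    simp only [Λ, hφdef]
    rw [intervalIntegral.integral_add ((hsp.const_mul c).intervalIntegrable _ _)
      (continuous_const.intervalIntegrable _ _), intervalIntegral.integral_const_mul]
    simp [hℓ]
  rw [this, hεdef]
  ring

end Lift

/-! ### Collapse of the fibres -/

section Fibres

variable {E F : Type*} [NormedAddCommGroup E] [NormedSpace ℝ E]
  [NormedAddCommGroup F] [NormedSpace ℝ F]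
  {G : Type*} [TopologicalSpace G] [ChartedSpace E G] [Group G]
  {H : Subgroup G} {k : Submodule ℝ (GroupLieAlgebra 𝓘(ℝ, E) G)}
  [ChartedSpace F (G ⧸ H)]
  [LieGroup 𝓘(ℝ, E) ∞ G] [FiniteDimensional ℝ E] [IsManifold 𝓘(ℝ, F) ∞ (G ⧸ H)]
  {Q : LinearMap.BilinForm ℝ (GroupLieAlgebra 𝓘(ℝ, E) G)}

omit [FiniteDimensional ℝ E] in
/-- The displacement of the base point along a one-parameter subgroup. -/
lemma riemannianDistance_isExpCurve_le
    (hpM : IsSubmersion 𝓘(ℝ, E) 𝓘(ℝ, F) ∞ (fun a : G => (a : G ⧸ H)))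
    {V : Submodule ℝ (GroupLieAlgebra 𝓘(ℝ, E) G)} {P : Module.End ℝ V}
    {g : SmoothMetric F (G ⧸ H)} (hg : IsMetricOf H Q V P g)
    {X : GroupLieAlgebra 𝓘(ℝ, E) G} {γ : ℝ → G} (hγ : IsExpCurve X γ) :
    riemannianDistance g ((1 : G) : G ⧸ H) (γ 1 : G ⧸ H) ≤
      ENNReal.ofReal (tangentNorm g ((1 : G) : G ⧸ H) (baseDifferential E F H X)) := by
  have hγc := contMDiff_of_isExpCurve hγ
  have h1 := riemannianDistance_le_lintegral_speed g (γ := (fun a : G => (a : G ⧸ H)) ∘ γ)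
    zero_le_one ((hpM.contMDiff.of_le (by simp)).comp hγc).contMDiffOn
  simp only [Function.comp_apply, hγ.1] at h1
  refine h1.trans_eq ?_
  have h2 : ∀ t, speed g ((fun a : G => (a : G ⧸ H)) ∘ γ) t =
      tangentNorm g ((1 : G) : G ⧸ H) (baseDifferential E F H X) := fun t => by
    rw [← hg.tangentNorm_mulInvariantVectorField hpM (γ t), ← velocity_of_isExpCurve hγ, speed,
      velocity_comp (F := E) (F' := F) (hpM.contMDiff.mdifferentiableAt (by simp))
        (hγc.mdifferentiableAt (by simp))]
    rfl
  simp [h2]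

/-- If the vertical parts of submersion metrics tend to zero, the base point is displaced by
elements of `K` by an amount tending to zero. -/
lemma tendsto_riemannianDistance_extendedSubgroup (hQ : IsAdInvariantInner Q)
    (hk : IsToralSubalgebra H k)
    (hpM : IsSubmersion 𝓘(ℝ, E) 𝓘(ℝ, F) ∞ (fun a : G => (a : G ⧸ H)))
    {P : ℕ → Module.End ℝ (Q.orthogonal (lieAlgebraOf H))}
    {gM : ℕ → SmoothMetric F (G ⧸ H)}
    (hgM : ∀ n, IsMetricOf H Q (Q.orthogonal (lieAlgebraOf H)) (P n) (gM n))
    (ht : ∀ X : Q.orthogonal (lieAlgebraOf H), (X : GroupLieAlgebra 𝓘(ℝ, E) G) ∈ k →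
      Tendsto (fun n => Q (P n X) X) atTop (𝓝 0))
    {a : G} (ha : a ∈ extendedSubgroup H k) :
    Tendsto (fun n => riemannianDistance (gM n) ((1 : G) : G ⧸ H) (a : G ⧸ H)) atTop (𝓝 0) := by
  -- Closure under products and inverses comes from the triangle inequality and the isometric
  -- action, so only the generators of `K` have to be tested.
  let S : Subgroup G :=
    { carrier := {a | Tendsto (fun n => riemannianDistance (gM n) ((1 : G) : G ⧸ H) (a : G ⧸ H))
        atTop (𝓝 0)}
      one_mem' := by simp [riemannianDistance_self]
      mul_mem' := by
        intro a b ha hb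
        have h1 : Tendsto (fun n => riemannianDistance (gM n) ((1 : G) : G ⧸ H) (a : G ⧸ H) +
            riemannianDistance (gM n) ((1 : G) : G ⧸ H) (b : G ⧸ H)) atTop (𝓝 0) := by
          simpa using Tendsto.add ha hb
        refine tendsto_of_tendsto_of_tendsto_of_le_of_le tendsto_const_nhds h1
          (fun n => zero_le) fun n => ?_
        refine (riemannianDistance_triangle (gM n) _ (a : G ⧸ H) _).trans_eq ?_
        rw [← (hgM n).riemannianDistance_smul hpM a ((1 : G) : G ⧸ H) (b : G ⧸ H)]
        simp
      inv_mem' := by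
        intro a ha
        refine Tendsto.congr (fun n => ?_) ha
        rw [← (hgM n).riemannianDistance_smul hpM a⁻¹ ((1 : G) : G ⧸ H) (a : G ⧸ H),
          riemannianDistance_comm]
        simp }
  have hle : extendedSubgroup H k ≤ S := by
    refine sup_le (fun a ha => ?_) ((Subgroup.closure_le S).2 ?_)
    · have h1 : (a : G ⧸ H) = ((1 : G) : G ⧸ H) := QuotientGroup.eq.2 (by simpa using ha)
      change Tendsto (fun n => riemannianDistance (gM n) ((1 : G) : G ⧸ H) (a : G ⧸ H)) _ _
      simp [h1, riemannianDistance_self]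
    · rintro a ⟨X, hX, γ, hγ, rfl⟩
      obtain ⟨T, hT, hXT⟩ := exists_vertical_part hQ hk hX
      have h1 : baseDifferential E F H X = baseDifferential E F H T := by
        rw [← sub_eq_zero, ← map_sub]
        exact baseDifferential_eq_zero hpM hXT
      have h2 : Tendsto (fun n => ENNReal.ofReal √(Q (P n T) T)) atTop (𝓝 0) := by
        simpa using ENNReal.tendsto_ofReal ((ht T hT).sqrt)
      refine tendsto_of_tendsto_of_tendsto_of_le_of_le tendsto_const_nhds h2
        (fun n => zero_le) fun n => ?_
      refine (riemannianDistance_isExpCurve_le hpM (hgM n) hγ).trans_eq ?_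
      rw [h1]
      exact congrArg _ ((hgM n).tangentNorm_baseDifferential T)
  exact hle ha

/-- The fibres of `G/H → G/K` collapse uniformly. -/
lemma eventually_forall_riemannianDistance_le [CompactSpace G] (hQ : IsAdInvariantInner Q)
    (hk : IsToralSubalgebra H k) (hK : IsClosed (extendedSubgroup H k : Set G))
    (hpM : IsSubmersion 𝓘(ℝ, E) 𝓘(ℝ, F) ∞ (fun a : G => (a : G ⧸ H)))
    {P : ℕ → Module.End ℝ (Q.orthogonal (lieAlgebraOf H))}
    {gM : ℕ → SmoothMetric F (G ⧸ H)}
    (hgM : ∀ n, IsMetricOf H Q (Q.orthogonal (lieAlgebraOf H)) (P n) (gM n))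
    (ht : ∀ X : Q.orthogonal (lieAlgebraOf H), (X : GroupLieAlgebra 𝓘(ℝ, E) G) ∈ k →
      Tendsto (fun n => Q (P n X) X) atTop (𝓝 0))
    {C : ℝ} (hC : 0 < C)
    (hPC : ∀ n (X : Q.orthogonal (lieAlgebraOf H)), Q (P n X) X ≤ C ^ 2 * Q (P 0 X) X)
    {ε : ℝ} (hε : 0 < ε) :
    ∀ᶠ n in atTop, ∀ x y : G ⧸ H, projection H k x = projection H k y →
      riemannianDistance (gM n) x y ≤ ENNReal.ofReal ε := by
  have hlip : ∀ n x y, riemannianDistance (gM n) x y ≤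
      ENNReal.ofReal C * riemannianDistance (gM 0) x y := fun n x y =>
    riemannianDistance_le_mul hQ hpM (hgM 0) (hgM n) hC (hPC n) x y
  have hsmall : 0 < ENNReal.ofReal (ε / (2 * C)) := by
    rw [ENNReal.ofReal_pos]; positivity
  -- Distances for every `n` are at most `C` times those for `0`, so this radius contributes at most
  -- `ε / 2` uniformly in `n`. The other half comes from the finitely many centres of the cover.
  let U : G → Set G := fun b =>
    {a | riemannianDistance (gM 0) (b : G ⧸ H) (a : G ⧸ H) < ENNReal.ofReal (ε / (2 * C))}
  have hU : ∀ b ∈ (extendedSubgroup H k : Set G), U b ∈ 𝓝 b := fun b _ =>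
    hpM.contMDiff.continuous.continuousAt.eventually
      (eventually_riemannianDistance_lt (gM 0) (b : G ⧸ H) hsmall)
  obtain ⟨t, htK, hcover⟩ := hK.isCompact.elim_nhds_subcover U hU
  have hhalf : (0 : ℝ≥0∞) < ENNReal.ofReal (ε / 2) := by
    rw [ENNReal.ofReal_pos]; positivity
  have hfin : ∀ᶠ n in atTop, ∀ b ∈ t,
      riemannianDistance (gM n) ((1 : G) : G ⧸ H) (b : G ⧸ H) < ENNReal.ofReal (ε / 2) :=
    (eventually_all_finset t).2 fun b hb =>
      (tendsto_riemannianDistance_extendedSubgroup hQ hk hpM hgM ht (htK b hb)).eventually_lt_const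
        hhalf
  filter_upwards [hfin] with n hn x y hxy
  obtain ⟨a, rfl⟩ := Quotient.mk_surjective x
  obtain ⟨b, rfl⟩ := Quotient.mk_surjective y
  -- Translating by `a⁻¹` moves any two points of one fibre to the base point and its translate by
  -- an element of `K`.
  have hab : a⁻¹ * b ∈ extendedSubgroup H k := QuotientGroup.eq.1 hxy
  obtain ⟨d, hd, habd⟩ := mem_iUnion₂.1 (hcover hab)
  have h1 := (hgM n).riemannianDistance_smul hpM a ((1 : G) : G ⧸ H) ((a⁻¹ * b : G) : G ⧸ H)
  simp only [MulAction.Quotient.smul_coe, smul_eq_mul, mul_one, mul_inv_cancel_left] at h1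
  refine h1.trans_le ((riemannianDistance_triangle (gM n) _ (d : G ⧸ H) _).trans ?_)
  refine (add_le_add (hn d hd).le
    ((hlip n _ _).trans (mul_le_mul_right (le_of_lt habd) _))).trans_eq ?_
  rw [← ENNReal.ofReal_mul hC.le, ← ENNReal.ofReal_add (by positivity) (by positivity)]
  congr 1
  field_simp
  ring

end Fibres

/-! ### From small distortion to Gromov–Hausdorff convergence -/

/-- A criterion for Gromov–Hausdorff convergence along a fixed surjection that is almost
`1`-Lipschitz and whose distortion tends to zero. -/
lemma gromovHausdorffTendsto_of_surjective {X Y : Type*} [Nonempty X]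
    {dX : ℕ → X → X → ℝ≥0∞} {dY : Y → Y → ℝ≥0∞}
    (hX : ∀ n, ∃ m : MetricSpace X, IsCompactMetric (dX n) m)
    (hY : ∃ m : MetricSpace Y, IsCompactMetric dY m) {f : X → Y} (hf : Function.Surjective f)
    (h : ∀ η : ℝ, 0 < η → ∀ᶠ n in atTop,
      (∀ x y, dY (f x) (f y) ≤ ENNReal.ofReal (1 + η) * dX n x y) ∧
      ∀ x y, ∀ r : ℝ, dY (f x) (f y) < ENNReal.ofReal r →
        dX n x y ≤ ENNReal.ofReal ((1 + η) * r + η)) :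
    GromovHausdorffTendsto dX dY := by
  choose mX hmX using hX
  obtain ⟨mY, hmY⟩ := hY
  have neY : Nonempty Y := Nonempty.map f ‹_›
  refine ⟨mX, mY, hmX, hmY, ‹_›, neY, ?_⟩
  have := hmY.compactSpace
  rw [Metric.tendsto_atTop']
  intro ε hε
  set D := Metric.diam (univ : Set Y) with hD
  have hDle : ∀ p q : Y, dist p q ≤ D := fun p q =>
    Metric.dist_le_diam_of_mem isCompact_univ.isBounded (mem_univ p) (mem_univ q)
  have hD0 : 0 ≤ D := Metric.diam_nonneg
  -- With `η ≤ 1`, distances in `X` are at most `(1 + η) * D + η ≤ 2 * D + 1`, so both one-sided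
  -- bounds give distortion at most `η * (2 * D + 1) ≤ ε`.
  set η := min 1 (ε / (2 * D + 1)) with hη
  have hη0 : 0 < η := lt_min one_pos (by positivity)
  have hη1 : η ≤ 1 := min_le_left _ _
  have hηε : η * (2 * D + 1) ≤ ε := by
    rw [← le_div_iff₀ (by positivity)]
    exact min_le_right _ _
  obtain ⟨N, hN⟩ := eventually_atTop.1 (h η hη0)
  refine ⟨N, fun n hn => ?_⟩
  obtain ⟨hA, hB⟩ := hN n hn.le
  let := mX n
  have := (hmX n).compactSpace
  have hXe : ∀ x y : X, dX n x y = ENNReal.ofReal (dist x y) := fun x y => by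
    rw [← (hmX n).edist_eq, edist_dist]
  have hYe : ∀ x y : Y, dY x y = ENNReal.ofReal (dist x y) := fun x y => by
    rw [← hmY.edist_eq, edist_dist]
  have hA' : ∀ x y : X, dist (f x) (f y) ≤ (1 + η) * dist x y := fun x y => by
    have := hA x y
    rwa [hXe, hYe, ← ENNReal.ofReal_mul (by positivity),
      ENNReal.ofReal_le_ofReal_iff (by positivity)] at this
  have hB' : ∀ x y : X, dist x y ≤ (1 + η) * dist (f x) (f y) + η := fun x y => by
    have h1 : ∀ r > dist (f x) (f y), dist x y ≤ (1 + η) * r + η := fun r hr => by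
      have hr0 : 0 < r := dist_nonneg.trans_lt hr
      have := hB x y r (by rw [hYe]; exact (ENNReal.ofReal_lt_ofReal_iff hr0).2 hr)
      rwa [hXe, ENNReal.ofReal_le_ofReal_iff (by positivity)] at this
    refine ge_of_tendsto (x := 𝓝[>] (dist (f x) (f y)))
      (f := fun r => (1 + η) * r + η) ?_ (eventually_mem_nhdsWithin.mono h1)
    exact (Continuous.tendsto (by fun_prop) _).mono_left nhdsWithin_le_nhds
  have hdist : ∀ x y : (univ : Set X),
      |dist x y - dist (f x) (f y)| ≤ η * (2 * D + 1) := fun x y => by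
    have h1 := hA' x y
    have h2 := hB' x y
    have h3 := hDle (f x) (f y)
    have h4 : (0 : ℝ) ≤ dist (f x) (f y) := dist_nonneg
    have h5 : dist x y = dist (x : X) y := rfl
    rw [h5, abs_le]
    have h6 : dist (x : X) y ≤ 2 * D + 1 := by nlinarith
    constructor <;> nlinarith
  -- The whole space is used as subset and `f` is onto, so both covering errors vanish and only half
  -- the distortion remains.
  have := GromovHausdorff.ghDist_le_of_approx_subsets (s := univ) (fun x : (univ : Set X) => f x)
    (ε₁ := 0) (ε₃ := 0) (fun x => ⟨x, mem_univ x, by simp⟩)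
    (fun y => by
      obtain ⟨x, rfl⟩ := hf y
      exact ⟨⟨x, mem_univ x⟩, by simp⟩) hdist
  have h7 : dist (GromovHausdorff.toGHSpace X) (GromovHausdorff.toGHSpace Y) ≤
      η * (2 * D + 1) / 2 := by simpa [GromovHausdorff.ghDist] using this
  refine h7.trans_lt ?_
  linarith

/-! ### Pinching of the metrics and conclusion -/

section Main

variable {E : Type*} [NormedAddCommGroup E] [NormedSpace ℝ E] [FiniteDimensional ℝ E]
  {G : Type*} [TopologicalSpace G] [ChartedSpace E G] [Group G]
  {H : Subgroup G} {k : Submodule ℝ (GroupLieAlgebra 𝓘(ℝ, E) G)}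
  {Q : LinearMap.BilinForm ℝ (GroupLieAlgebra 𝓘(ℝ, E) G)}

lemma tendsto_bilinForm_left (Q : LinearMap.BilinForm ℝ (GroupLieAlgebra 𝓘(ℝ, E) G))
    {Z : ℕ → GroupLieAlgebra 𝓘(ℝ, E) G} {Z₀ : GroupLieAlgebra 𝓘(ℝ, E) G}
    (h : Tendsto Z atTop (𝓝 Z₀)) (Y : GroupLieAlgebra 𝓘(ℝ, E) G) :
    Tendsto (fun n => Q (Z n) Y) atTop (𝓝 (Q Z₀ Y)) := by
  let q : E →ₗ[ℝ] ℝ :=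
    { toFun := fun Z => Q Z Y
      map_add' := fun a b => (Q.flip Y).map_add a b
      map_smul' := fun c a => (Q.flip Y).map_smul c a }
  exact (q.continuous_of_finiteDimensional.tendsto Z₀).comp h

/-- The bilinear form `Q (P X) Y` on a subspace `W` of the domain of `P`. -/
def restrictedForm (Q : LinearMap.BilinForm ℝ (GroupLieAlgebra 𝓘(ℝ, E) G))
    {V W : Submodule ℝ (GroupLieAlgebra 𝓘(ℝ, E) G)} (hWV : W ≤ V) (P : Module.End ℝ V) :
    LinearMap.BilinForm ℝ W :=
  Q.compl₁₂ (V.subtype ∘ₗ P ∘ₗ Submodule.inclusion hWV) W.subtype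

omit [FiniteDimensional ℝ E] in
lemma restrictedForm_apply {V W : Submodule ℝ (GroupLieAlgebra 𝓘(ℝ, E) G)} (hWV : W ≤ V)
    (P : Module.End ℝ V) (X Y : W) :
    restrictedForm Q hWV P X Y = Q (P (Submodule.inclusion hWV X)) Y := rfl

/-- The horizontal parts of the metrics are eventually pinched. -/
lemma eventually_form_le (hQ : IsAdInvariantInner Q) (hk : IsToralSubalgebra H k)
    {P : ℕ → Module.End ℝ (Q.orthogonal (lieAlgebraOf H))}
    {L : Subgroup G} {Pinf : Module.End ℝ (Q.orthogonal k)}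
    (hPinf : IsInvariantMetricEndo Q L (Q.orthogonal k) Pinf)
    (hn : ∀ (X : Q.orthogonal (lieAlgebraOf H)) (Y : Q.orthogonal k),
      (X : GroupLieAlgebra 𝓘(ℝ, E) G) = Y →
        Tendsto (fun n => (P n X : GroupLieAlgebra 𝓘(ℝ, E) G)) atTop
          (𝓝 (Pinf Y : GroupLieAlgebra 𝓘(ℝ, E) G)))
    {η : ℝ} (hη : 0 < η) :
    ∀ᶠ n in atTop, ∀ (X : Q.orthogonal (lieAlgebraOf H)) (Y : Q.orthogonal k),
      (X : GroupLieAlgebra 𝓘(ℝ, E) G) = Y →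
        Q (Pinf Y) Y ≤ (1 + η) ^ 2 * Q (P n X) X ∧ Q (P n X) X ≤ (1 + η) ^ 2 * Q (Pinf Y) Y := by
  have : FiniteDimensional ℝ (GroupLieAlgebra 𝓘(ℝ, E) G) := ‹FiniteDimensional ℝ E›
  have hle : Q.orthogonal k ≤ Q.orthogonal (lieAlgebraOf H) := orthogonal_le_orthogonal hk
  have hlim : ∀ X Y : Q.orthogonal k, Tendsto (fun n => restrictedForm Q hle (P n) X Y) atTop
      (𝓝 (restrictedForm Q le_rfl Pinf X Y)) := fun X Y =>
    tendsto_bilinForm_left Q (hn (Submodule.inclusion hle X) X rfl) Y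
  -- With `δ = η / (1 + η)` one has `1 - δ = 1 / (1 + η)` and `1 + δ ≤ 1 + η`, so one closeness
  -- estimate yields both inequalities, even with the first power of `1 + η`.
  have hδ : 0 < η / (1 + η) := by positivity
  filter_upwards [eventually_abs_sub_le (restrictedForm Q le_rfl Pinf)
    (fun X Y => (hPinf.symm X Y).trans (hQ.symm _ _)) hPinf.pos hlim hδ] with n hn' X Y hXY
  have h1 := abs_le.1 (hn' Y)
  have hX : Submodule.inclusion hle Y = X := Subtype.ext hXY.symm
  have e1 : restrictedForm Q hle (P n) Y Y = Q (P n X) X := by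
    rw [restrictedForm_apply, hX, hXY]
  have e2 : restrictedForm Q le_rfl Pinf Y Y = Q (Pinf Y) Y := rfl
  rw [e1, e2] at h1
  have h0 : 0 ≤ Q (Pinf Y) Y := by
    rcases eq_or_ne Y 0 with rfl | h
    · simp
    · exact (hPinf.pos Y h).le
  set u := Q (Pinf Y) Y
  set v := Q (P n X) X
  obtain ⟨h1, h2⟩ := h1
  have h3 : η / (1 + η) * u * (1 + η) = η * u := by field_simp
  have h4 : u ≤ (1 + η) * v := by nlinarith
  have h5 : v ≤ (1 + η) * u := by nlinarith
  have h6 : 0 ≤ v := by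
    by_contra hv
    nlinarith
  constructor <;> nlinarith [mul_nonneg hη.le h6, mul_nonneg hη.le h0,
    mul_nonneg (sq_nonneg η) h6, mul_nonneg (sq_nonneg η) h0]

/-- Submersion metrics with converging vertical and horizontal parts are uniformly bounded. -/
lemma exists_forall_form_le (hQ : IsAdInvariantInner Q) (hk : IsToralSubalgebra H k)
    {P : ℕ → Module.End ℝ (Q.orthogonal (lieAlgebraOf H))}
    (hP : ∀ n, IsSubmersionMetric Q H k (P n)) {Pinf : Module.End ℝ (Q.orthogonal k)}
    (ht : ∀ X : Q.orthogonal (lieAlgebraOf H), (X : GroupLieAlgebra 𝓘(ℝ, E) G) ∈ k →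
      Tendsto (fun n => (P n X : GroupLieAlgebra 𝓘(ℝ, E) G)) atTop (𝓝 0))
    (hn : ∀ (X : Q.orthogonal (lieAlgebraOf H)) (Y : Q.orthogonal k),
      (X : GroupLieAlgebra 𝓘(ℝ, E) G) = Y →
        Tendsto (fun n => (P n X : GroupLieAlgebra 𝓘(ℝ, E) G)) atTop
          (𝓝 (Pinf Y : GroupLieAlgebra 𝓘(ℝ, E) G))) :
    ∃ C > 0, ∀ n (X : Q.orthogonal (lieAlgebraOf H)), Q (P n X) X ≤ C ^ 2 * Q (P 0 X) X := by
  have : FiniteDimensional ℝ (GroupLieAlgebra 𝓘(ℝ, E) G) := ‹FiniteDimensional ℝ E›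
  have h0 := (hP 0).isInvariantMetricEndo
  refine exists_forall_le_of_tendsto (restrictedForm Q le_rfl (P 0))
    (fun X Y => (h0.symm X Y).trans (hQ.symm _ _)) h0.pos
    (b := fun n => restrictedForm Q le_rfl (P n)) fun X Y => ?_
  -- The `k`-component of a vector of `m` again lies in `m`, hence in `t`; the two convergence
  -- hypotheses then give convergence of the form on all of `m`.
  obtain ⟨U, hU, N, hN, hUN⟩ := exists_add_mem_orthogonal hQ.symm hQ.pos k
    (X : GroupLieAlgebra 𝓘(ℝ, E) G)
  have hNm : N ∈ Q.orthogonal (lieAlgebraOf H) := orthogonal_le_orthogonal hk hN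
  have hUm : U ∈ Q.orthogonal (lieAlgebraOf H) := by
    rw [← eq_sub_iff_add_eq] at hUN
    rw [hUN]
    exact Submodule.sub_mem _ X.2 hNm
  have hX : X = ⟨U, hUm⟩ + ⟨N, hNm⟩ := Subtype.ext hUN.symm
  have h1 := tendsto_bilinForm_left Q (ht ⟨U, hUm⟩ hU) Y
  have h2 := tendsto_bilinForm_left Q (hn ⟨N, hNm⟩ ⟨N, hN⟩ rfl) Y
  refine ⟨_, (h1.add h2).congr fun n => ?_⟩
  change _ = Q (P n X) Y
  rw [hX, map_add, Submodule.coe_add, map_add, LinearMap.add_apply]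

end Main

end HomogeneousCollapse

end

theorem mainTheorem4
    -- `G` is a compact Lie group
    {E : Type*} [NormedAddCommGroup E] [NormedSpace ℝ E] [FiniteDimensional ℝ E]
    {G : Type*} [TopologicalSpace G] [ChartedSpace E G] [Group G] [LieGroup 𝓘(ℝ, E) ∞ G]
    [T2Space G] [CompactSpace G]
    -- `H` is a closed subgroup, `k` is a toral `H`-subalgebra such that `K` is closed
    (H : Subgroup G) (hH : IsClosed (H : Set G))
    (k : Submodule ℝ (GroupLieAlgebra 𝓘(ℝ, E) G))
    (hk : HomogeneousCollapse.IsToralSubalgebra H k)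
    (hK : IsClosed (HomogeneousCollapse.extendedSubgroup H k : Set G))
    -- the smooth structure of `M = G/H`, for which `G → G/H` is a smooth submersion
    {F : Type*} [NormedAddCommGroup F] [NormedSpace ℝ F] [FiniteDimensional ℝ F]
    [ChartedSpace F (G ⧸ H)] [IsManifold 𝓘(ℝ, F) ∞ (G ⧸ H)]
    (hπM : IsSubmersion 𝓘(ℝ, E) 𝓘(ℝ, F) ∞ (fun a : G => (a : G ⧸ H)))
    [ConnectedSpace (G ⧸ H)]
    -- the smooth structure of `N = G/K`, for which `G → G/K` is a smooth submersion
    {F' : Type*} [NormedAddCommGroup F'] [NormedSpace ℝ F'] [FiniteDimensional ℝ F']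
    [ChartedSpace F' (G ⧸ HomogeneousCollapse.extendedSubgroup H k)]
    [IsManifold 𝓘(ℝ, F') ∞ (G ⧸ HomogeneousCollapse.extendedSubgroup H k)]
    (hπN : IsSubmersion 𝓘(ℝ, E) 𝓘(ℝ, F') ∞
      (fun a : G => (a : G ⧸ HomogeneousCollapse.extendedSubgroup H k)))
    -- the background inner product on the Lie algebra
    (Q : LinearMap.BilinForm ℝ (GroupLieAlgebra 𝓘(ℝ, E) G))
    (hQ : HomogeneousCollapse.IsAdInvariantInner Q)
    -- a sequence of `k`-submersion metrics on `M`, and an invariant metric on `N`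
    (P : ℕ → Module.End ℝ (Q.orthogonal (HomogeneousCollapse.lieAlgebraOf H)))
    (hP : ∀ n, HomogeneousCollapse.IsSubmersionMetric Q H k (P n))
    (Pinf : Module.End ℝ (Q.orthogonal k))
    (hPinf : HomogeneousCollapse.IsInvariantMetricEndo Q
      (HomogeneousCollapse.extendedSubgroup H k) (Q.orthogonal k) Pinf)
    -- the restrictions to `t = k ∩ m` tend to `0`, those to `n = k^⊥` tend to `Pinf`
    (ht : ∀ X : Q.orthogonal (HomogeneousCollapse.lieAlgebraOf H),
      (X : GroupLieAlgebra 𝓘(ℝ, E) G) ∈ k →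
        Tendsto (fun n => (P n X : GroupLieAlgebra 𝓘(ℝ, E) G)) atTop (𝓝 0))
    (hn : ∀ (X : Q.orthogonal (HomogeneousCollapse.lieAlgebraOf H)) (Y : Q.orthogonal k),
      (X : GroupLieAlgebra 𝓘(ℝ, E) G) = Y →
        Tendsto (fun n => (P n X : GroupLieAlgebra 𝓘(ℝ, E) G)) atTop
          (𝓝 (Pinf Y : GroupLieAlgebra 𝓘(ℝ, E) G)))
    -- the corresponding Riemannian metrics on `M` and on `N`
    (gM : ℕ → HomogeneousCollapse.SmoothMetric F (G ⧸ H))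
    (hgM : ∀ n, HomogeneousCollapse.IsMetricOf H Q
      (Q.orthogonal (HomogeneousCollapse.lieAlgebraOf H)) (P n) (gM n))
    (gN : HomogeneousCollapse.SmoothMetric F' (G ⧸ HomogeneousCollapse.extendedSubgroup H k))
    (hgN : HomogeneousCollapse.IsMetricOf (HomogeneousCollapse.extendedSubgroup H k) Q
      (Q.orthogonal k) Pinf gN) :
    HomogeneousCollapse.GromovHausdorffTendsto
      (fun n => HomogeneousCollapse.riemannianDistance (gM n))
      (HomogeneousCollapse.riemannianDistance gN) := by
  have : IsTopologicalGroup G := topologicalGroup_of_lieGroup 𝓘(ℝ, E) ∞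
  -- Closedness of `H` and of `K` provides the Hausdorff property of the two quotients.
  have := hH
  have := hK
  have hKT2 : T2Space (G ⧸ HomogeneousCollapse.extendedSubgroup H k) := inferInstance
  have hproj := HomogeneousCollapse.contMDiff_projection hπM hπN
  have hsurj : Function.Surjective (HomogeneousCollapse.projection H k) := by
    intro q
    obtain ⟨a, rfl⟩ := Quotient.mk_surjective q
    exact ⟨(a : G ⧸ H), rfl⟩
  have : ConnectedSpace (G ⧸ HomogeneousCollapse.extendedSubgroup H k) :=
    hsurj.connectedSpace hproj.continuous
  have htQ : ∀ X : Q.orthogonal (HomogeneousCollapse.lieAlgebraOf H),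
      (X : GroupLieAlgebra 𝓘(ℝ, E) G) ∈ k → Tendsto (fun n => Q (P n X) X) atTop (𝓝 0) := by
    intro X hX
    simpa using HomogeneousCollapse.tendsto_bilinForm_left Q (ht X hX) X
  obtain ⟨C, hC, hPC⟩ := HomogeneousCollapse.exists_forall_form_le hQ hk hP ht hn
  refine HomogeneousCollapse.gromovHausdorffTendsto_of_surjective
    (fun n => HomogeneousCollapse.exists_isCompactMetric (gM n))
    (HomogeneousCollapse.exists_isCompactMetric gN) hsurj fun η hη => ?_
  filter_upwards [HomogeneousCollapse.eventually_form_le hQ hk hPinf hn hη,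
    HomogeneousCollapse.eventually_forall_riemannianDistance_le hQ hk hK hπM hgM htQ hC hPC hη]
    with n hform hfibre
  have h1η : 0 < 1 + η := by linarith
  refine ⟨HomogeneousCollapse.riemannianDistance_projection_le hQ hk hπM hπN (hP n) (hgM n) hgN h1η
    fun X Y hXY => (hform X Y hXY).1, fun x y r hr => ?_⟩
  -- First reach the fibre of `y` at a point `z`, at cost `(1 + η) * r`; then move inside that fibre
  -- from `z` to `y`, at cost `η`.
  obtain ⟨z, hz, hxz⟩ :=
    HomogeneousCollapse.exists_projection_eq_riemannianDistance_le hQ hk hπM hπN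
      (hgM n) hgN h1η (fun X Y hXY => (hform X Y hXY).2) x _ hr
  have hr0 : 0 < r := ENNReal.ofReal_pos.1 (zero_le.trans_lt hr)
  rw [ENNReal.ofReal_add (by positivity) hη.le]
  exact (HomogeneousCollapse.riemannianDistance_triangle (gM n) x z y).trans
    (add_le_add hxz (hfibre z y hz))
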